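/- Let $c_1,c_3,c_5,r_2,r_4,\tau>0$ and $a_0\neq 0$ be real, and put $$a_1=2\pi c_3\frac{2c_1}{c_1+c_3},\qquad a_2=2\pi c_3\frac{c_1-c_3}{c_1+c_3},\qquad a_5=\frac{2c_5}{c_5+c_3},$$ $$A=\begin{pmatrix}-a_1r_2&0&a_1a_0\\0&-(a_1-a_2)r_4a_5&0\\0&0&-1\end{pmatrix},\qquad B=\begin{pmatrix}0&0&0\\-a_5a_1r_2&0&a_2a_0a_5\\0&-\frac{a_5r_4}{a_0}&0\end{pmatrix},$$ $$C=\begin{pmatrix}0&0&0\\0&0&0\\-\frac{a_1r_2(a_5-1)}{(a_1-a_2)a_0}&0&\frac{a_2(a_5-1)}{a_1-a_2}\end{pmatrix},\qquad E(\epsilon)=\mathrm{diag}(1,1,\epsilon),$$ $$\Delta(\epsilon,s)=sE(\epsilon)-A-Be^{-\tau s}-Ce^{-2\tau s}\quad(s\in\mathbb C).$$ For $\epsilon>0$ let $$M(\epsilon)=\begin{pmatrix}m_1&-\frac{r_4}{r_2}m_2&\frac{a_0}{r_2}m_3\\-\frac{r_2}{r_4}m_1&m_2&-\frac{a_0}{r_4}m_3\\\frac{r_2}{a_0}m_1&-\frac{r_4}{a_0}m_2&m_3\end{pmatrix},$$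 where $m_1=\frac{a_1a_5r_4}{g}$, $m_2=\frac{a_1a_5r_2}{g}$, $m_3=\frac{a_1a_5r_4}{g}r_2(a_1-a_2)$ and $g=a_1a_5\left[r_2+r_4+2\tau r_2r_4(a_1-a_2)+\epsilon r_2r_4(a_1-a_2)\right]$. Let $\epsilon>0$. Then $\lambda=0$ is a simple root of $\det\Delta(\epsilon,\cdot)$, and for every $t\in\mathbb R$ the function $s\mapsto e^{st}\Delta(\epsilon,s)^{-1}$ has at $s=0$ a simple pole with residue $M(\epsilon)$, that is, $\lim_{s\to0}s\,e^{st}\Delta(\epsilon,s)^{-1}=M(\epsilon)$. Moreover, let $h:[0,\infty)\to\mathbb R^3$ satisfy $\|h(t)\|\le K_1e^{-\beta t}$ for all $t\ge0$, with constants $K_1,\beta>0$, let $\varphi:[-2\tau,0]\to\mathbb R^3$ be continuous, and let $x$ be a solution of $$\frac{d}{dt}\bigl(E(\epsilon)x(t)\bigr)=Ax(t)+Bx(t-\tau)+Cx(t-2\tau)+h(t),\quad t\ge0,\qquad x=\varphi\ \text{on }[-2\tau,0]$$ (that is, $x$ is continuous on $[-2\tau,\infty)$, $E(\epsilon)x$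 is locally absolutely continuous on $[0,\infty)$, and the equation holds for almost every $t>0$; for continuous $h$ these are the classical solutions). Then $h$ is integrable on $(0,\infty)$ and $$\lim_{t\to\infty}x(t)=M(\epsilon)\left[E(\epsilon)\varphi(0)+B\int_0^\tau\varphi(\theta-\tau)\,d\theta+C\int_0^{2\tau}\varphi(\theta-2\tau)\,d\theta\right]+M(\epsilon)\int_0^\infty h(\theta)\,d\theta.$$ -/

import Mathlib

open Filter Topology MeasureTheory Matrix

/-- Dimensionless parameters of the two-layer scattering system: `cᵢ = cos θᵢ / nᵢ` for the three
dielectrics, the damping parameters `r₂, r₄` of the layers, the dimensionless vector potential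
`a₀`, and the delay `τ`. -/
structure LayerParams where
  c₁ : ℝ
  c₃ : ℝ
  c₅ : ℝ
  r₂ : ℝ
  r₄ : ℝ
  a₀ : ℝ
  τ : ℝ

namespace LayerParams

noncomputable section

variable (p : LayerParams)

/-- The parameters are in the physical range. -/
structure Admissible : Prop where
  c₁_pos : 0 < p.c₁
  c₃_pos : 0 < p.c₃
  c₅_pos : 0 < p.c₅
  r₂_pos : 0 < p.r₂
  r₄_pos : 0 < p.r₄
  a₀_ne : p.a₀ ≠ 0
  τ_pos : 0 < p.τ

def a₁ : ℝ := 2 * Real.pi * p.c₃ * (2 * p.c₁ / (p.c₁ + p.c₃))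

def a₂ : ℝ := 2 * Real.pi * p.c₃ * ((p.c₁ - p.c₃) / (p.c₁ + p.c₃))

def a₅ : ℝ := 2 * p.c₅ / (p.c₅ + p.c₃)

def matA : Matrix (Fin 3) (Fin 3) ℝ :=
  !![-(p.a₁ * p.r₂), 0, p.a₁ * p.a₀;
     0, -((p.a₁ - p.a₂) * p.r₄ * p.a₅), 0;
     0, 0, -1]

def matB : Matrix (Fin 3) (Fin 3) ℝ :=
  !![0, 0, 0;
     -(p.a₅ * p.a₁ * p.r₂), 0, p.a₂ * p.a₀ * p.a₅;
     0, -(p.a₅ * p.r₄ / p.a₀), 0]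

def matC : Matrix (Fin 3) (Fin 3) ℝ :=
  !![0, 0, 0;
     0, 0, 0;
     -(p.a₁ * p.r₂ * (p.a₅ - 1) / ((p.a₁ - p.a₂) * p.a₀)), 0,
       p.a₂ * (p.a₅ - 1) / (p.a₁ - p.a₂)]

/-- The matrix `E(ε) = diag(1, 1, ε)`. -/
def matE (ε : ℝ) : Matrix (Fin 3) (Fin 3) ℝ := Matrix.diagonal ![1, 1, ε]

/-- The characteristic matrix `Δ(ε, s) = s E(ε) - A - B e^{-τ s} - C e^{-2τ s}`. -/
def charMatrix (ε : ℝ) (s : ℂ) : Matrix (Fin 3) (Fin 3) ℂ :=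
  s • (matE ε).map Complex.ofReal - p.matA.map Complex.ofReal
    - Complex.exp (-(p.τ * s)) • p.matB.map Complex.ofReal
    - Complex.exp (-(2 * p.τ * s)) • p.matC.map Complex.ofReal

/-- The number `g(ε, 0)`. -/
def g₀ (ε : ℝ) : ℝ :=
  p.a₁ * p.a₅ * (p.r₂ + p.r₄ + 2 * p.τ * p.r₂ * p.r₄ * (p.a₁ - p.a₂)
    + ε * p.r₂ * p.r₄ * (p.a₁ - p.a₂))

def m₁ (ε : ℝ) : ℝ := p.a₁ * p.a₅ * p.r₄ / p.g₀ ε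

def m₂ (ε : ℝ) : ℝ := p.a₁ * p.a₅ * p.r₂ / p.g₀ ε

def m₃ (ε : ℝ) : ℝ := p.a₁ * p.a₅ * p.r₄ / p.g₀ ε * (p.r₂ * (p.a₁ - p.a₂))

/-- The explicit matrix `M(ε)`. -/
def matM (ε : ℝ) : Matrix (Fin 3) (Fin 3) ℝ :=
  !![p.m₁ ε, -(p.r₄ / p.r₂ * p.m₂ ε), p.a₀ / p.r₂ * p.m₃ ε;
     -(p.r₂ / p.r₄ * p.m₁ ε), p.m₂ ε, -(p.a₀ / p.r₄ * p.m₃ ε);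
     p.r₂ / p.a₀ * p.m₁ ε, -(p.r₄ / p.a₀ * p.m₂ ε), p.m₃ ε]

/-- `x` solves `d/dt (E(ε) x(t)) = A x(t) + B x(t-τ) + C x(t-2τ) + h(t)` for `t ≥ 0`, with
`x = φ` on `[-2τ, 0]`. The equation is understood in the sense of Carathéodory, so that `h` may be
discontinuous: `E(ε) x` is locally absolutely continuous on `[0, ∞)` and the equation holds for
almost every `t > 0`. For continuous `h` these are exactly the classical solutions. Only the values
of `x` on `[-2τ, ∞)`, of `φ` on `[-2τ, 0]` and of `h` on `(0, ∞)` matter. -/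
structure IsSolution (ε : ℝ) (φ h x : ℝ → Fin 3 → ℝ) : Prop where
  continuousOn : ContinuousOn x (Set.Ici (-(2 * p.τ)))
  initial : ∀ t ∈ Set.Icc (-(2 * p.τ)) 0, x t = φ t
  absCont : ∀ T : ℝ, 0 ≤ T → AbsolutelyContinuousOnInterval (fun t => matE ε *ᵥ x t) 0 T
  equation : ∀ᵐ t : ℝ, 0 < t →
    HasDerivAt (fun u => matE ε *ᵥ x u)
      (p.matA *ᵥ x t + p.matB *ᵥ x (t - p.τ) + p.matC *ᵥ x (t - 2 * p.τ) + h t) t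

end

end LayerParams

/-! ### Absolutely continuous functions and their almost everywhere derivatives -/

/-! The root and the residue come from Cramer's rule: `det Δ` vanishes at `0` with derivative `g₀ >
0`, and `adj Δ(ε, 0) = g₀ M(ε)`.

Convergence is proved without spectral theory, by energy and charge. With `v = r₂x₁`, `q = r₄x₂`, `u
= a₀x₃` the equation becomes a loop of two layers with reflection coefficients `ρ = (c₁-c₃)/(c₁+c₃)`
and `σ = (c₅-c₃)/(c₅+c₃)`, both in `(-1, 1)`, exchanging the waves `w` and `z`. The energy `v²/kv +
q²/kq + εu²` together with the integrals of `w²` and `z²` over the last delay decreases at the rate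
`dissipation`, apart from the power of the sources (`energy_add_integral_dissipation_le`). The
sources are integrable, so the energy is bounded and the dissipation integrable; the trajectory is
therefore Lipschitz, and Barbalat's lemma gives `u - v → 0` and `w(t-τ) - q → 0`. Hence `v' → 0`,
and `q`, `w`, `z`, `u` approach `-v`, `-v`, `v`, `v`.

It remains to see that `v` converges. The charge `v/kv - q/kq + εu`, minus the integral of `w` and
plus that of `z` over the last delay, changes only through the sources (`charge_balance`).
Asymptotically it equals `stiffness * v`, so `v` tends to `totalCharge / stiffness`. Expressed in
the original variables this is the rank-one matrix `M(ε)` applied to the data. -/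

theorem AbsolutelyContinuousOnInterval.integral_eq_sub_of_ae_hasDerivAt {f f' : ℝ → ℝ} {a b : ℝ}
    (hab : a ≤ b) (hf : AbsolutelyContinuousOnInterval f a b)
    (hf' : ∀ᵐ t, a < t → HasDerivAt f (f' t) t) :
    ∫ t in a..b, f' t = f b - f a := by
  rw [← hf.integral_deriv_eq_sub]
  apply intervalIntegral.integral_congr_ae
  filter_upwards [hf'] with t ht hmem
  rw [Set.uIoc_of_le hab] at hmem
  exact (ht hmem.1).deriv.symm

theorem AbsolutelyContinuousOnInterval.abs_sub_le_of_ae_hasDerivAt {f f' : ℝ → ℝ} {a b L : ℝ}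
    (hab : a ≤ b) (hf : AbsolutelyContinuousOnInterval f a b)
    (hf' : ∀ᵐ t, a < t → HasDerivAt f (f' t) t) (hL : ∀ t, a < t → |f' t| ≤ L) :
    |f b - f a| ≤ L * (b - a) := by
  rw [← hf.integral_eq_sub_of_ae_hasDerivAt hab hf']
  have := intervalIntegral.norm_integral_le_of_norm_le_const (f := f') (a := a) (b := b) (C := L)
    (fun t ht => by rw [Set.uIoc_of_le hab] at ht; exact hL t ht.1)
  rwa [Real.norm_eq_abs, abs_of_nonneg (sub_nonneg.2 hab)] at this

/-! ### Behaviour at infinity -/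

/-- A Barbalat lemma: a square integrable Lipschitz function tends to zero. -/
theorem tendsto_zero_of_lipschitz_of_integral_sq_le {f : ℝ → ℝ} {T₀ L I : ℝ}
    (hc : Continuous f) (hL : ∀ s t, T₀ ≤ s → s ≤ t → |f t - f s| ≤ L * (t - s))
    (hI : ∀ T, T₀ ≤ T → ∫ t in T₀..T, f t ^ 2 ≤ I) : Tendsto f atTop (𝓝 0) := by
  have h_int : IntegrableOn (fun t => f t ^ 2) (Set.Ioi T₀) := by
    refine integrableOn_Ioi_of_intervalIntegral_norm_bounded (l := atTop) (b := id) I T₀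
      (fun i => ((hc.pow 2).integrableOn_Icc).mono_set Set.Ioc_subset_Icc_self) tendsto_id ?_
    filter_upwards [eventually_ge_atTop T₀] with T hT
    simpa using hI T hT
  have hlim := intervalIntegral_tendsto_integral_Ioi T₀ h_int tendsto_id
  have hii : ∀ a b : ℝ, IntervalIntegrable (fun t => f t ^ 2) volume a b := fun a b =>
    (hc.pow 2).intervalIntegrable a b
  rw [Metric.tendsto_atTop]
  intro η hη
  -- On a window of length `δ` the function moves by at most `M * δ = η / 2`, so `|f t| ≥ η` would
  -- force the integral of `f ^ 2` over it to be at least `δ * (η / 2) ^ 2`. The `+ 1` keeps `M`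
  -- positive.
  set M : ℝ := |L| + 1 with hM
  have hM0 : 0 < M := by positivity
  set δ : ℝ := η / (2 * M) with hδ
  have hδ0 : 0 < δ := by positivity
  have hwin : Tendsto (fun t : ℝ => ∫ s in t..(t + δ), f s ^ 2) atTop (𝓝 0) := by
    have h2 := (hlim.comp (tendsto_atTop_add_const_right atTop δ tendsto_id)).sub hlim
    rw [sub_self] at h2
    refine h2.congr fun t => ?_
    simp only [Function.comp, id]
    rw [intervalIntegral.integral_interval_sub_left (hii _ _) (hii _ _)]
  have hpos : 0 < δ * (η / 2) ^ 2 := by positivity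
  obtain ⟨T, hT⟩ := (Metric.tendsto_atTop.1 hwin) _ hpos
  refine ⟨max T T₀, fun t ht => ?_⟩
  have htT : T ≤ t := (le_max_left _ _).trans ht
  have htT₀ : T₀ ≤ t := (le_max_right _ _).trans ht
  have h1 := hT t htT
  rw [Real.dist_eq, sub_zero] at h1 ⊢
  by_contra hcon
  push Not at hcon
  have hle : ∫ s in t..(t + δ), (η / 2) ^ 2 ≤ ∫ s in t..(t + δ), f s ^ 2 := by
    refine intervalIntegral.integral_mono_on (by linarith) (by simp) (hii _ _) fun s hs => ?_
    have h3 := hL t s htT₀ hs.1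
    have h4 : L * (s - t) ≤ M * δ := by
      have : L ≤ M := by rw [hM]; linarith [le_abs_self L]
      have h5 : s - t ≤ δ := by linarith [hs.2]
      exact (mul_le_mul_of_nonneg_right this (by linarith [hs.1])).trans
        (mul_le_mul_of_nonneg_left h5 hM0.le)
    have h5 : M * δ = η / 2 := by rw [hδ]; field_simp
    have h6 : |f t| - |f s| ≤ |f s - f t| := by
      rw [abs_sub_comm]; exact abs_sub_abs_le_abs_sub _ _
    rw [← sq_abs (f s)]
    exact pow_le_pow_left₀ (by positivity) (by linarith) 2
  rw [intervalIntegral.integral_const, smul_eq_mul, add_sub_cancel_left] at hle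
  linarith [le_abs_self (∫ s in t..(t + δ), f s ^ 2)]

/-- A nonnegative function whose growth is controlled by an integrable multiple of its square root
is bounded. -/
theorem sqrt_le_of_le_add_integral_mul_sqrt {N H : ℝ → ℝ} {V : ℝ} (hN : Continuous N)
    (hN0 : ∀ t, 0 ≤ N t) (hH0 : ∀ t, 0 ≤ H t) (hH : IntegrableOn H (Set.Ioi 0)) (hV : 0 ≤ V)
    (hle : ∀ T, 0 ≤ T → N T ≤ V + ∫ t in (0 : ℝ)..T, H t * √(N t)) :
    ∀ T, 0 ≤ T → √(N T) ≤ 1 + V + ∫ t in Set.Ioi (0 : ℝ), H t := by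
  intro T hT
  obtain ⟨S, hS, hmax⟩ := isCompact_Icc.exists_isMaxOn (Set.nonempty_Icc.2 hT)
    (Real.continuous_sqrt.comp hN).continuousOn
  have hmax' : ∀ t ∈ Set.Icc 0 T, √(N t) ≤ √(N S) := fun t ht => hmax ht
  refine (hmax' T ⟨hT, le_rfl⟩).trans ?_
  set m := √(N S) with hm
  have hm0 : 0 ≤ m := Real.sqrt_nonneg _
  have hHi : IntervalIntegrable H volume 0 S :=
    (intervalIntegrable_iff_integrableOn_Ioc_of_le hS.1).2 (hH.mono_set Set.Ioc_subset_Ioi_self)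
  have h1 : ∫ t in (0 : ℝ)..S, H t * √(N t) ≤ ∫ t in (0 : ℝ)..S, H t * m := by
    refine intervalIntegral.integral_mono_on hS.1
      (hHi.mul_continuousOn (Real.continuous_sqrt.comp hN).continuousOn) (hHi.mul_const m)
      fun t ht => ?_
    exact mul_le_mul_of_nonneg_left (hmax' t ⟨ht.1, ht.2.trans hS.2⟩) (hH0 t)
  have h2 : ∫ t in (0 : ℝ)..S, H t ≤ ∫ t in Set.Ioi (0 : ℝ), H t := by
    rw [intervalIntegral.integral_of_le hS.1]
    exact setIntegral_mono_set hH (ae_of_all _ hH0) Set.Ioc_subset_Ioi_self.eventuallyLE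
  rw [intervalIntegral.integral_mul_const] at h1
  have h3 : m ^ 2 = N S := Real.sq_sqrt (hN0 S)
  have h4 := hle S hS.1
  set G := ∫ t in Set.Ioi (0 : ℝ), H t
  have h5 : m ^ 2 ≤ V + G * m := by
    rw [h3]; nlinarith [mul_le_mul_of_nonneg_right h2 hm0]
  -- If `m > 1 + V + G`, then `m > 1` and `m ^ 2 > (1 + V + G) * m ≥ V + G * m`.
  by_contra hcon
  push Not at hcon
  have hG : 0 ≤ G := setIntegral_nonneg measurableSet_Ioi fun t _ => hH0 t
  nlinarith

theorem tendsto_integral_window_zero {f : ℝ → ℝ} (τ : ℝ) (hf : Tendsto f atTop (𝓝 0)) :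
    Tendsto (fun t => ∫ s in (t - τ)..t, f s) atTop (𝓝 0) := by
  rw [Metric.tendsto_atTop] at hf ⊢
  intro η hη
  obtain ⟨T, hT⟩ := hf (η / (|τ| + 1)) (by positivity)
  refine ⟨T + |τ|, fun t ht => ?_⟩
  have h1 := intervalIntegral.norm_integral_le_of_norm_le_const (f := f) (a := t - τ) (b := t)
    (C := η / (|τ| + 1)) (fun s hs => by
      have h2 : T ≤ s := by
        have := hs.1
        rcases le_total (t - τ) t with h | h
        · rw [min_eq_left h] at this; linarith [le_abs_self τ]
        · rw [min_eq_right h] at this; linarith [abs_nonneg τ]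
      have := hT s h2
      rw [dist_zero_right] at this
      exact this.le)
  rw [dist_zero_right]
  refine h1.trans_lt ?_
  rw [sub_sub_cancel, div_mul_eq_mul_div, div_lt_iff₀ (by positivity)]
  nlinarith

/-- The increments of `f` over bounded windows tend to zero at infinity. -/
def SlowlyVarying (f : ℝ → ℝ) : Prop :=
  ∀ η > 0, ∃ T, ∀ s t, T ≤ s → s ≤ t → |f t - f s| ≤ η * (t - s)

theorem SlowlyVarying.tendsto_shift_sub {f : ℝ → ℝ} (hf : SlowlyVarying f) {τ : ℝ} (hτ : 0 < τ) :
    Tendsto (fun t => f t - f (t - τ)) atTop (𝓝 0) := by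
  rw [Metric.tendsto_atTop]
  intro η hη
  obtain ⟨T, hT⟩ := hf (η / (2 * τ)) (by positivity)
  refine ⟨T + τ, fun t ht => ?_⟩
  have h1 := hT (t - τ) t (by linarith) (by linarith)
  rw [sub_sub_cancel] at h1
  have h2 : η / (2 * τ) * τ = η / 2 := by field_simp
  rw [dist_zero_right, Real.norm_eq_abs]
  linarith

/-- A slowly varying function is nearly constant on a window of fixed length. This evaluates the
integrals of the waves under way in terms of `v` before `v` is known to converge. -/
theorem SlowlyVarying.tendsto_integral_window_sub {f : ℝ → ℝ} (hf : SlowlyVarying f)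
    (hc : Continuous f) {τ : ℝ} (hτ : 0 < τ) :
    Tendsto (fun t => (∫ s in (t - τ)..t, f s) - τ * f t) atTop (𝓝 0) := by
  rw [Metric.tendsto_atTop]
  intro η hη
  obtain ⟨T, hT⟩ := hf (η / (2 * τ * τ)) (by positivity)
  refine ⟨T + τ, fun t ht => ?_⟩
  have h0 : (∫ s in (t - τ)..t, f s) - τ * f t = ∫ s in (t - τ)..t, (f s - f t) := by
    rw [intervalIntegral.integral_sub (hc.intervalIntegrable _ _) (by simp)]
    simp
  have h1 := intervalIntegral.norm_integral_le_of_norm_le_const (f := fun s => f s - f t)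
    (a := t - τ) (b := t) (C := η / (2 * τ)) (fun s hs => by
      rw [Set.uIoc_of_le (by linarith)] at hs
      have h2 := hT s t (by linarith [hs.1]) hs.2
      rw [Real.norm_eq_abs, abs_sub_comm]
      have h3 : η / (2 * τ * τ) * (t - s) ≤ η / (2 * τ * τ) * τ :=
        mul_le_mul_of_nonneg_left (by linarith [hs.1]) (by positivity)
      have h4 : η / (2 * τ * τ) * τ = η / (2 * τ) := by field_simp
      linarith)
  rw [dist_zero_right, h0]
  rw [sub_sub_cancel, abs_of_pos hτ] at h1
  have h2 : η / (2 * τ) * τ = η / 2 := by field_simp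
  linarith

theorem slowlyVarying_of_ae_hasDerivAt {f f' : ℝ → ℝ}
    (hac : ∀ T, 0 ≤ T → AbsolutelyContinuousOnInterval f 0 T)
    (hf' : ∀ᵐ t, 0 < t → HasDerivAt f (f' t) t) (hlim : Tendsto f' atTop (𝓝 0)) :
    SlowlyVarying f := by
  intro η hη
  obtain ⟨T, hT⟩ := (Metric.tendsto_atTop.1 hlim) η hη
  refine ⟨max T 0, fun s t hs hst => ?_⟩
  have hs0 : 0 ≤ s := (le_max_right _ _).trans hs
  have hsT : T ≤ s := (le_max_left _ _).trans hs
  refine ((hac t (hs0.trans hst)).mono ?_).abs_sub_le_of_ae_hasDerivAt hst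
    (f' := f') (hf'.mono fun r hr hsr => hr (hs0.trans_lt hsr)) fun r hr => ?_
  · rw [Set.uIcc_of_le hst, Set.uIcc_of_le (hs0.trans hst)]
    exact Set.Icc_subset_Icc_left hs0
  · have := hT r (hsT.trans hr.le)
    rw [dist_zero_right] at this
    exact this.le

/-- Both sides are the integral over `[-τ, T]`. It converts differences of delayed and present waves
into integrals over one delay. -/
theorem integral_comp_sub_add_integral {f : ℝ → ℝ} (hf : Continuous f) (τ T : ℝ) :
    (∫ t in (0 : ℝ)..T, f (t - τ)) + ∫ t in (T - τ)..T, f t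
      = (∫ t in (-τ)..0, f t) + ∫ t in (0 : ℝ)..T, f t := by
  rw [intervalIntegral.integral_comp_sub_right, zero_sub,
    intervalIntegral.integral_add_adjacent_intervals (hf.intervalIntegrable _ _)
      (hf.intervalIntegrable _ _),
    intervalIntegral.integral_add_adjacent_intervals (hf.intervalIntegrable _ _)
      (hf.intervalIntegrable _ _)]

/-! ### Two dissipative layers coupled by delayed waves -/

/-- A trajectory of two dissipative layers with states `v` and `q` and reflection coefficients
`ρ` and `σ`, coupled through waves that travel with delay `τ`; the wave that reaches the first
layer is smoothed to `u` with relaxation time `ε`. -/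
structure LayerLoop where
  ρ : ℝ
  σ : ℝ
  kv : ℝ
  kq : ℝ
  ε : ℝ
  τ : ℝ
  v : ℝ → ℝ
  q : ℝ → ℝ
  u : ℝ → ℝ
  h₁ : ℝ → ℝ
  h₂ : ℝ → ℝ
  h₃ : ℝ → ℝ
  K : ℝ
  neg_one_lt_ρ : -1 < ρ
  ρ_lt_one : ρ < 1
  neg_one_lt_σ : -1 < σ
  σ_lt_one : σ < 1
  kv_pos : 0 < kv
  kq_pos : 0 < kq
  ε_pos : 0 < ε
  τ_pos : 0 < τ
  continuous_v : Continuous v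
  continuous_q : Continuous q
  continuous_u : Continuous u
  absCont_v : ∀ T, 0 ≤ T → AbsolutelyContinuousOnInterval v 0 T
  absCont_q : ∀ T, 0 ≤ T → AbsolutelyContinuousOnInterval q 0 T
  absCont_u : ∀ T, 0 ≤ T → AbsolutelyContinuousOnInterval u 0 T
  integrable_h₁ : IntegrableOn h₁ (Set.Ioi 0)
  integrable_h₂ : IntegrableOn h₂ (Set.Ioi 0)
  integrable_h₃ : IntegrableOn h₃ (Set.Ioi 0)
  abs_h₁_le : ∀ t, 0 < t → |h₁ t| ≤ K
  abs_h₂_le : ∀ t, 0 < t → |h₂ t| ≤ K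
  abs_h₃_le : ∀ t, 0 < t → |h₃ t| ≤ K
  tendsto_h₁ : Tendsto h₁ atTop (𝓝 0)
  tendsto_h₂ : Tendsto h₂ atTop (𝓝 0)
  tendsto_h₃ : Tendsto h₃ atTop (𝓝 0)
  hasDerivAt_v : ∀ᵐ t, 0 < t → HasDerivAt v (kv * (1 + ρ) * (u t - v t) + h₁ t) t
  hasDerivAt_q : ∀ᵐ t, 0 < t → HasDerivAt q
    (kq * (1 + σ) * (ρ * u (t - τ) - (1 + ρ) * v (t - τ) - q t) + h₂ t) t
  hasDerivAt_u : ∀ᵐ t, 0 < t → HasDerivAt u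
    ((σ * (ρ * u (t - τ - τ) - (1 + ρ) * v (t - τ - τ)) - (1 + σ) * q (t - τ) - u t + h₃ t) / ε) t

namespace LayerLoop

noncomputable section

variable (S : LayerLoop)

/-- The wave leaving the first layer. -/
def w (t : ℝ) : ℝ := S.ρ * S.u t - (1 + S.ρ) * S.v t

/-- The wave leaving the second layer. -/
def z (t : ℝ) : ℝ := S.σ * S.w (t - S.τ) - (1 + S.σ) * S.q t

def rateV (t : ℝ) : ℝ := S.kv * (1 + S.ρ) * (S.u t - S.v t) + S.h₁ t

def rateQ (t : ℝ) : ℝ := S.kq * (1 + S.σ) * (S.w (t - S.τ) - S.q t) + S.h₂ t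

def rateU (t : ℝ) : ℝ := (S.z (t - S.τ) - S.u t + S.h₃ t) / S.ε

theorem continuous_w : Continuous S.w := by
  have := S.continuous_u
  have := S.continuous_v
  unfold w
  fun_prop

theorem continuous_z : Continuous S.z := by
  have := S.continuous_w
  have := S.continuous_q
  unfold z
  fun_prop

theorem hasDerivAt_v_rateV : ∀ᵐ t, 0 < t → HasDerivAt S.v (S.rateV t) t := S.hasDerivAt_v

theorem hasDerivAt_q_rateQ : ∀ᵐ t, 0 < t → HasDerivAt S.q (S.rateQ t) t := S.hasDerivAt_q

theorem hasDerivAt_u_rateU : ∀ᵐ t, 0 < t → HasDerivAt S.u (S.rateU t) t := S.hasDerivAt_u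

/-- The energy stored in the two layers and the smoothed wave. -/
def energy (t : ℝ) : ℝ := S.v t ^ 2 / S.kv + S.q t ^ 2 / S.kq + S.ε * S.u t ^ 2

/-- One square for each layer and one for the smoothing of `u`; the first two have positive weights
because `|ρ|, |σ| < 1`. -/
def dissipation (t : ℝ) : ℝ :=
  (1 - S.ρ ^ 2) * (S.u t - S.v t) ^ 2 + (1 - S.σ ^ 2) * (S.w (t - S.τ) - S.q t) ^ 2
    + (S.z (t - S.τ) - S.u t) ^ 2

/-- The power supplied by the sources. -/
def power (t : ℝ) : ℝ :=
  2 / S.kv * (S.v t * S.h₁ t) + 2 / S.kq * (S.q t * S.h₂ t) + 2 * (S.u t * S.h₃ t)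

theorem continuous_energy : Continuous S.energy := by
  have := S.continuous_u
  have := S.continuous_v
  have := S.continuous_q
  unfold energy
  fun_prop

theorem continuous_dissipation : Continuous S.dissipation := by
  have := S.continuous_u
  have := S.continuous_v
  have := S.continuous_q
  have := S.continuous_w
  have := S.continuous_z
  unfold dissipation
  fun_prop

theorem one_sub_ρ_sq_pos : 0 < 1 - S.ρ ^ 2 := by nlinarith [S.neg_one_lt_ρ, S.ρ_lt_one]

theorem one_sub_σ_sq_pos : 0 < 1 - S.σ ^ 2 := by nlinarith [S.neg_one_lt_σ, S.σ_lt_one]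

theorem energy_nonneg (t : ℝ) : 0 ≤ S.energy t := by
  have := S.kv_pos
  have := S.kq_pos
  have := S.ε_pos
  unfold energy
  positivity

theorem dissipation_nonneg (t : ℝ) : 0 ≤ S.dissipation t := by
  have := S.one_sub_ρ_sq_pos
  have := S.one_sub_σ_sq_pos
  unfold dissipation
  positivity

theorem intervalIntegrable_of_integrableOn_Ioi {f : ℝ → ℝ} (hf : IntegrableOn f (Set.Ioi 0))
    {T : ℝ} (hT : 0 ≤ T) : IntervalIntegrable f volume 0 T :=
  (intervalIntegrable_iff_integrableOn_Ioc_of_le hT).2 (hf.mono_set Set.Ioc_subset_Ioi_self)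

theorem intervalIntegrable_power {T : ℝ} (hT : 0 ≤ T) :
    IntervalIntegrable S.power volume 0 T := by
  have i₁ := intervalIntegrable_of_integrableOn_Ioi S.integrable_h₁ hT
  have i₂ := intervalIntegrable_of_integrableOn_Ioi S.integrable_h₂ hT
  have i₃ := intervalIntegrable_of_integrableOn_Ioi S.integrable_h₃ hT
  exact (((i₁.continuousOn_mul S.continuous_v.continuousOn).const_mul _).add
    ((i₂.continuousOn_mul S.continuous_q.continuousOn).const_mul _)).add
    ((i₃.continuousOn_mul S.continuous_u.continuousOn).const_mul _)

theorem absCont_energy {T : ℝ} (hT : 0 ≤ T) : AbsolutelyContinuousOnInterval S.energy 0 T := by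
  have hv := ((S.absCont_v T hT).fun_mul (S.absCont_v T hT)).const_mul (1 / S.kv)
  have hq := ((S.absCont_q T hT).fun_mul (S.absCont_q T hT)).const_mul (1 / S.kq)
  have hu := ((S.absCont_u T hT).fun_mul (S.absCont_u T hT)).const_mul S.ε
  have heq : S.energy = (fun t => 1 / S.kv * (S.v t * S.v t))
      + (fun t => 1 / S.kq * (S.q t * S.q t)) + fun t => S.ε * (S.u t * S.u t) := by
    funext t
    simp only [energy, Pi.add_apply]
    ring
  rw [heq]
  exact (hv.add hq).add hu

/-- Sum of three scattering identities, where `w'` and `z'` are taken at `t - τ`: `2(1+ρ)v(u-v) = u²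
- w² - (1-ρ²)(u-v)²`, `2(1+σ)q(w'-q) = w'² - z² - (1-σ²)(w'-q)²` and `2u(z'-u) = z'² - u² -
(z'-u)²`. -/
theorem hasDerivAt_energy : ∀ᵐ t, 0 < t → HasDerivAt S.energy
    (S.w (t - S.τ) ^ 2 - S.w t ^ 2 + (S.z (t - S.τ) ^ 2 - S.z t ^ 2) - S.dissipation t
      + S.power t) t := by
  filter_upwards [S.hasDerivAt_v_rateV, S.hasDerivAt_q_rateQ, S.hasDerivAt_u_rateU]
    with t hv hq hu ht
  have hd := (((hv ht).pow 2).div_const S.kv).add (((hq ht).pow 2).div_const S.kq) |>.add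
    (((hu ht).pow 2).const_mul S.ε)
  convert! hd using 1
  have h1 := S.kv_pos.ne'
  have h2 := S.kq_pos.ne'
  have h3 := S.ε_pos.ne'
  simp only [rateV, rateQ, rateU, dissipation, power, z]
  -- Delayed waves become atoms, so that `w` is unfolded at time `t` only.
  generalize S.w (t - S.τ) = wt
  generalize S.w (t - S.τ - S.τ) = wtt
  simp only [w]
  field_simp
  ring

/-- The energy supplied initially, including that of the waves under way. -/
def initialEnergy : ℝ :=
  S.energy 0 + (∫ t in (-S.τ)..0, S.w t ^ 2) + ∫ t in (-S.τ)..0, S.z t ^ 2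

theorem initialEnergy_nonneg : 0 ≤ S.initialEnergy := by
  have h : -S.τ ≤ 0 := by linarith [S.τ_pos]
  have h1 := intervalIntegral.integral_nonneg h (μ := volume) fun t _ => sq_nonneg (S.w t)
  have h2 := intervalIntegral.integral_nonneg h (μ := volume) fun t _ => sq_nonneg (S.z t)
  have := S.energy_nonneg 0
  unfold initialEnergy
  positivity

/-- Integrating the energy rate leaves the wave energy over `[-τ, 0]`, which is part of
`initialEnergy`, and over `[T - τ, T]`, which is nonnegative and dropped. -/
theorem energy_add_integral_dissipation_le {T : ℝ} (hT : 0 ≤ T) :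
    S.energy T + ∫ t in (0 : ℝ)..T, S.dissipation t
      ≤ S.initialEnergy + ∫ t in (0 : ℝ)..T, S.power t := by
  have hw := S.continuous_w
  have hz := S.continuous_z
  have key := (S.absCont_energy hT).integral_eq_sub_of_ae_hasDerivAt hT S.hasDerivAt_energy
  have ii : ∀ f : ℝ → ℝ, Continuous f → IntervalIntegrable f volume 0 T := fun f hf =>
    hf.intervalIntegrable _ _
  have iw := ii (fun t => S.w t ^ 2) (by fun_prop)
  have iwt := ii (fun t => S.w (t - S.τ) ^ 2) (by fun_prop)
  have iz := ii (fun t => S.z t ^ 2) (by fun_prop)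
  have izt := ii (fun t => S.z (t - S.τ) ^ 2) (by fun_prop)
  have idis := ii _ S.continuous_dissipation
  rw [intervalIntegral.integral_add (((iwt.sub iw).add (izt.sub iz)).sub idis)
      (S.intervalIntegrable_power hT),
    intervalIntegral.integral_sub ((iwt.sub iw).add (izt.sub iz)) idis,
    intervalIntegral.integral_add (iwt.sub iw) (izt.sub iz),
    intervalIntegral.integral_sub iwt iw, intervalIntegral.integral_sub izt iz] at key
  have sw := integral_comp_sub_add_integral (f := fun t => S.w t ^ 2) (by fun_prop) S.τ T
  have sz := integral_comp_sub_add_integral (f := fun t => S.z t ^ 2) (by fun_prop) S.τ T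
  have h : T - S.τ ≤ T := by linarith [S.τ_pos]
  have pw := intervalIntegral.integral_nonneg h (μ := volume) fun t _ => sq_nonneg (S.w t)
  have pz := intervalIntegral.integral_nonneg h (μ := volume) fun t _ => sq_nonneg (S.z t)
  unfold initialEnergy
  linarith

theorem abs_le_sqrt_mul_sqrt_of_sq_div_le {a k N : ℝ} (hk : 0 < k) (h : a ^ 2 / k ≤ N) :
    |a| ≤ √k * √N := by
  rw [← Real.sqrt_mul hk.le]
  apply Real.abs_le_sqrt
  rwa [div_le_iff₀ hk, mul_comm] at h

theorem abs_v_le (t : ℝ) : |S.v t| ≤ √S.kv * √(S.energy t) := by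
  apply abs_le_sqrt_mul_sqrt_of_sq_div_le S.kv_pos
  have := S.kq_pos
  have := S.ε_pos
  have h : 0 ≤ S.q t ^ 2 / S.kq + S.ε * S.u t ^ 2 := by positivity
  unfold energy
  linarith

theorem abs_q_le (t : ℝ) : |S.q t| ≤ √S.kq * √(S.energy t) := by
  apply abs_le_sqrt_mul_sqrt_of_sq_div_le S.kq_pos
  have := S.kv_pos
  have := S.ε_pos
  have h : 0 ≤ S.v t ^ 2 / S.kv + S.ε * S.u t ^ 2 := by positivity
  unfold energy
  linarith

theorem abs_u_le (t : ℝ) : |S.u t| ≤ √(1 / S.ε) * √(S.energy t) := by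
  have h3 := S.ε_pos
  apply abs_le_sqrt_mul_sqrt_of_sq_div_le (by positivity)
  have := S.kv_pos
  have := S.kq_pos
  have h : 0 ≤ S.v t ^ 2 / S.kv + S.q t ^ 2 / S.kq := by positivity
  have h' : S.u t ^ 2 / (1 / S.ε) = S.ε * S.u t ^ 2 := by field_simp
  unfold energy
  linarith

/-- The factor by which the sources control the power relative to the root of the energy. -/
def gain (t : ℝ) : ℝ :=
  2 / S.kv * √S.kv * |S.h₁ t| + 2 / S.kq * √S.kq * |S.h₂ t| + 2 * √(1 / S.ε) * |S.h₃ t|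

theorem gain_nonneg (t : ℝ) : 0 ≤ S.gain t := by
  have := S.kv_pos
  have := S.kq_pos
  unfold gain
  positivity

theorem integrableOn_gain : IntegrableOn S.gain (Set.Ioi 0) :=
  ((S.integrable_h₁.norm.const_mul _).add (S.integrable_h₂.norm.const_mul _)).add
    (S.integrable_h₃.norm.const_mul _)

theorem power_le (t : ℝ) : S.power t ≤ S.gain t * √(S.energy t) := by
  have hkv := S.kv_pos
  have hkq := S.kq_pos
  have aux : ∀ a c h k : ℝ, 0 ≤ c → |a| ≤ k * √(S.energy t) →
      c * (a * h) ≤ c * k * |h| * √(S.energy t) := by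
    intro a c h k hc ha
    calc c * (a * h) ≤ c * (|a| * |h|) := by
          rw [← abs_mul]; exact mul_le_mul_of_nonneg_left (le_abs_self _) hc
      _ ≤ c * (k * √(S.energy t) * |h|) :=
          mul_le_mul_of_nonneg_left (mul_le_mul_of_nonneg_right ha (abs_nonneg _)) hc
      _ = _ := by ring
  have e₁ := aux _ (2 / S.kv) (S.h₁ t) _ (by positivity) (S.abs_v_le t)
  have e₂ := aux _ (2 / S.kq) (S.h₂ t) _ (by positivity) (S.abs_q_le t)
  have e₃ := aux _ 2 (S.h₃ t) _ (by positivity) (S.abs_u_le t)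
  unfold power gain
  linarith

theorem integral_power_le {T : ℝ} (hT : 0 ≤ T) :
    ∫ t in (0 : ℝ)..T, S.power t ≤ ∫ t in (0 : ℝ)..T, S.gain t * √(S.energy t) :=
  intervalIntegral.integral_mono_on hT (S.intervalIntegrable_power hT)
    ((intervalIntegrable_of_integrableOn_Ioi S.integrableOn_gain hT).mul_continuousOn
      (Real.continuous_sqrt.comp S.continuous_energy).continuousOn) fun t _ => S.power_le t

/-- A bound for the root of the energy. -/
def bound : ℝ := 1 + S.initialEnergy + ∫ t in Set.Ioi (0 : ℝ), S.gain t

theorem sqrt_energy_le {T : ℝ} (hT : 0 ≤ T) : √(S.energy T) ≤ S.bound := by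
  refine sqrt_le_of_le_add_integral_mul_sqrt S.continuous_energy S.energy_nonneg S.gain_nonneg
    S.integrableOn_gain S.initialEnergy_nonneg (fun T hT => ?_) T hT
  have h1 := S.energy_add_integral_dissipation_le hT
  have h2 := S.integral_power_le hT
  have h3 := intervalIntegral.integral_nonneg hT (μ := volume) fun t _ => S.dissipation_nonneg t
  linarith

theorem integral_dissipation_le {T : ℝ} (hT : 0 ≤ T) :
    ∫ t in (0 : ℝ)..T, S.dissipation t
      ≤ S.initialEnergy + S.bound * ∫ t in Set.Ioi (0 : ℝ), S.gain t := by
  have h1 := S.energy_add_integral_dissipation_le hT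
  have h2 := S.integral_power_le hT
  have h3 := S.energy_nonneg T
  have hg := intervalIntegrable_of_integrableOn_Ioi S.integrableOn_gain hT
  have h4 : ∫ t in (0 : ℝ)..T, S.gain t * √(S.energy t) ≤ ∫ t in (0 : ℝ)..T, S.gain t * S.bound :=
    intervalIntegral.integral_mono_on hT
      (hg.mul_continuousOn (Real.continuous_sqrt.comp S.continuous_energy).continuousOn)
      (hg.mul_const _) fun t ht =>
        mul_le_mul_of_nonneg_left (S.sqrt_energy_le ht.1) (S.gain_nonneg t)
  rw [intervalIntegral.integral_mul_const] at h4
  have h5 : ∫ t in (0 : ℝ)..T, S.gain t ≤ ∫ t in Set.Ioi (0 : ℝ), S.gain t := by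
    rw [intervalIntegral.integral_of_le hT]
    exact setIntegral_mono_set S.integrableOn_gain (ae_of_all _ S.gain_nonneg)
      Set.Ioc_subset_Ioi_self.eventuallyLE
  have hb : 0 ≤ S.bound := (Real.sqrt_nonneg _).trans (S.sqrt_energy_le le_rfl)
  nlinarith [mul_le_mul_of_nonneg_right h5 hb]

/-! ### Boundedness and Lipschitz continuity of the trajectory -/

theorem exists_abs_le {f : ℝ → ℝ} {a R : ℝ} (hf : Continuous f) (h : ∀ t, 0 ≤ t → |f t| ≤ R) :
    ∃ C, ∀ t, a ≤ t → |f t| ≤ C := by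
  obtain ⟨C, hC⟩ := isCompact_Icc.exists_bound_of_continuousOn (s := Set.Icc a 0)
    (f := f) hf.continuousOn
  refine ⟨max C R, fun t ht => ?_⟩
  rcases le_total t 0 with h0 | h0
  · exact (hC t ⟨ht, h0⟩).trans (le_max_left _ _)
  · exact (h t h0).trans (le_max_right _ _)

/-- The states and the wave are bounded from time `-2τ` on. -/
theorem exists_bound : ∃ C, ∀ t, -S.τ - S.τ ≤ t → |S.v t| ≤ C ∧ |S.q t| ≤ C ∧ |S.u t| ≤ C := by
  have hb : ∀ k T, 0 ≤ k → 0 ≤ T → k * √(S.energy T) ≤ k * S.bound := fun k T hk hT =>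
    mul_le_mul_of_nonneg_left (S.sqrt_energy_le hT) hk
  obtain ⟨C₁, h₁⟩ := exists_abs_le (a := -S.τ - S.τ) S.continuous_v
    fun t ht => (S.abs_v_le t).trans (hb _ t (Real.sqrt_nonneg _) ht)
  obtain ⟨C₂, h₂⟩ := exists_abs_le (a := -S.τ - S.τ) S.continuous_q
    fun t ht => (S.abs_q_le t).trans (hb _ t (Real.sqrt_nonneg _) ht)
  obtain ⟨C₃, h₃⟩ := exists_abs_le (a := -S.τ - S.τ) S.continuous_u
    fun t ht => (S.abs_u_le t).trans (hb _ t (Real.sqrt_nonneg _) ht)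
  exact ⟨max C₁ (max C₂ C₃), fun t ht => ⟨(h₁ t ht).trans (le_max_left _ _),
    (h₂ t ht).trans ((le_max_left _ _).trans (le_max_right _ _)),
    (h₃ t ht).trans ((le_max_right _ _).trans (le_max_right _ _))⟩⟩

theorem abs_one_add_le {r : ℝ} (h₁ : -1 < r) (h₂ : r < 1) : |1 + r| ≤ 2 :=
  abs_le.2 ⟨by linarith, by linarith⟩

theorem abs_w_sub_le {C s t : ℝ} (hv : |S.v t - S.v s| ≤ C) (hu : |S.u t - S.u s| ≤ C) :
    |S.w t - S.w s| ≤ 3 * C := by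
  have h1 : |S.ρ * (S.u t - S.u s)| ≤ 1 * C := by
    rw [abs_mul]
    exact mul_le_mul (abs_le.2 ⟨S.neg_one_lt_ρ.le, S.ρ_lt_one.le⟩) hu (abs_nonneg _) zero_le_one
  have h2 : |(1 + S.ρ) * (S.v t - S.v s)| ≤ 2 * C := by
    rw [abs_mul]
    exact mul_le_mul (abs_one_add_le S.neg_one_lt_ρ S.ρ_lt_one) hv (abs_nonneg _) zero_le_two
  have h3 : S.w t - S.w s = S.ρ * (S.u t - S.u s) - (1 + S.ρ) * (S.v t - S.v s) := by
    unfold w; ring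
  rw [h3]
  linarith [abs_sub (S.ρ * (S.u t - S.u s)) ((1 + S.ρ) * (S.v t - S.v s))]

theorem exists_bound_w_z :
    ∃ C, ∀ t, 0 ≤ t → |S.v t| ≤ C ∧ |S.q t| ≤ C ∧ |S.u t| ≤ C ∧ |S.w (t - S.τ)| ≤ C
      ∧ |S.z (t - S.τ)| ≤ C := by
  obtain ⟨C, hC⟩ := S.exists_bound
  have hτ := S.τ_pos
  -- At `t ≥ 0` the wave `z (t - τ)` contains `w (t - 2τ)`, so the bound must start at `-2τ`.
  have hw : ∀ t, -S.τ - S.τ ≤ t → |S.w t| ≤ 3 * C := by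
    intro t ht
    obtain ⟨h1, h2, h3⟩ := hC t ht
    have e1 : |S.ρ * S.u t| ≤ 1 * C := by
      rw [abs_mul]
      exact mul_le_mul (abs_le.2 ⟨S.neg_one_lt_ρ.le, S.ρ_lt_one.le⟩) h3 (abs_nonneg _) zero_le_one
    have e2 : |(1 + S.ρ) * S.v t| ≤ 2 * C := by
      rw [abs_mul]
      exact mul_le_mul (abs_one_add_le S.neg_one_lt_ρ S.ρ_lt_one) h1 (abs_nonneg _) zero_le_two
    have := abs_sub (S.ρ * S.u t) ((1 + S.ρ) * S.v t)
    unfold w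
    linarith
  have hz : ∀ t, -S.τ ≤ t → |S.z t| ≤ 5 * C := by
    intro t ht
    have e1 : |S.σ * S.w (t - S.τ)| ≤ 1 * (3 * C) := by
      rw [abs_mul]
      exact mul_le_mul (abs_le.2 ⟨S.neg_one_lt_σ.le, S.σ_lt_one.le⟩) (hw _ (by linarith))
        (abs_nonneg _) zero_le_one
    have e2 : |(1 + S.σ) * S.q t| ≤ 2 * C := by
      rw [abs_mul]
      exact mul_le_mul (abs_one_add_le S.neg_one_lt_σ S.σ_lt_one) (hC t (by linarith)).2.1
        (abs_nonneg _) zero_le_two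
    have := abs_sub (S.σ * S.w (t - S.τ)) ((1 + S.σ) * S.q t)
    unfold z
    linarith
  have hC0 : 0 ≤ C := (abs_nonneg _).trans (hC 0 (by linarith)).1
  refine ⟨5 * C, fun t ht => ?_⟩
  obtain ⟨h1, h2, h3⟩ := hC t (by linarith)
  exact ⟨by linarith, by linarith, by linarith, (hw _ (by linarith)).trans (by linarith),
    hz _ (by linarith)⟩

theorem abs_sub_le_of_rate_le {f f' : ℝ → ℝ} {L : ℝ}
    (hac : ∀ T, 0 ≤ T → AbsolutelyContinuousOnInterval f 0 T)
    (hf' : ∀ᵐ t, 0 < t → HasDerivAt f (f' t) t) (hL : ∀ t, 0 < t → |f' t| ≤ L) {s t : ℝ}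
    (hs : 0 ≤ s) (hst : s ≤ t) : |f t - f s| ≤ L * (t - s) := by
  refine ((hac t (hs.trans hst)).mono ?_).abs_sub_le_of_ae_hasDerivAt hst
    (f' := f') (hf'.mono fun r hr hsr => hr (hs.trans_lt hsr)) fun r hr => hL r (hs.trans_lt hr)
  rw [Set.uIcc_of_le hst, Set.uIcc_of_le (hs.trans hst)]
  exact Set.Icc_subset_Icc_left hs

/-- The trajectory is Lipschitz on `[0, ∞)`. -/
theorem exists_lipschitz : ∃ L, ∀ s t, 0 ≤ s → s ≤ t → |S.v t - S.v s| ≤ L * (t - s) ∧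
    |S.q t - S.q s| ≤ L * (t - s) ∧ |S.u t - S.u s| ≤ L * (t - s) := by
  obtain ⟨C, hC⟩ := S.exists_bound_w_z
  have hkv := S.kv_pos
  have hkq := S.kq_pos
  have hε := S.ε_pos
  have hρ : 0 < 1 + S.ρ := by linarith [S.neg_one_lt_ρ]
  have hσ : 0 < 1 + S.σ := by linarith [S.neg_one_lt_σ]
  -- The common shape of the three rates; for `u` it is used with `k = 1`, before division by `ε`.
  have hadd : ∀ {k a b h : ℝ}, 0 < k → |a| ≤ C → |b| ≤ C → |h| ≤ S.K →
      |k * (a - b) + h| ≤ k * (2 * C) + S.K := by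
    intro k a b h hk ha hb hh
    have e := mul_le_mul_of_nonneg_left ((abs_sub a b).trans (add_le_add ha hb)) hk.le
    have e2 := abs_add_le (k * (a - b)) h
    rw [abs_mul, abs_of_pos hk] at e2
    linarith
  have l₁ := fun s t => abs_sub_le_of_rate_le (s := s) (t := t) S.absCont_v S.hasDerivAt_v_rateV
    (fun t ht => hadd (mul_pos hkv hρ) (hC t ht.le).2.2.1 (hC t ht.le).1 (S.abs_h₁_le t ht))
  have l₂ := fun s t => abs_sub_le_of_rate_le (s := s) (t := t) S.absCont_q S.hasDerivAt_q_rateQ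
    (fun t ht => hadd (mul_pos hkq hσ) (hC t ht.le).2.2.2.1 (hC t ht.le).2.1 (S.abs_h₂_le t ht))
  have l₃ := fun s t => abs_sub_le_of_rate_le (s := s) (t := t) (L := (1 * (2 * C) + S.K) / S.ε)
    S.absCont_u S.hasDerivAt_u_rateU (fun t ht => by
      rw [rateU, abs_div, abs_of_pos hε]
      have := hadd one_pos (hC t ht.le).2.2.2.2 (hC t ht.le).2.2.1 (S.abs_h₃_le t ht)
      rw [one_mul] at this
      gcongr)
  set L₁ := S.kv * (1 + S.ρ) * (2 * C) + S.K
  set L₂ := S.kq * (1 + S.σ) * (2 * C) + S.K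
  set L₃ := (1 * (2 * C) + S.K) / S.ε
  refine ⟨max L₁ (max L₂ L₃), fun s t hs hst => ?_⟩
  have h0 : 0 ≤ t - s := by linarith
  exact ⟨(l₁ s t hs hst).trans (mul_le_mul_of_nonneg_right (le_max_left _ _) h0),
    (l₂ s t hs hst).trans (mul_le_mul_of_nonneg_right
      ((le_max_left _ _).trans (le_max_right _ _)) h0),
    (l₃ s t hs hst).trans (mul_le_mul_of_nonneg_right
      ((le_max_right _ _).trans (le_max_right _ _)) h0)⟩

/-! ### Asymptotic alignment of states and waves -/

/-- Barbalat's lemma for one square of the dissipation. The Lipschitz estimate is asked only from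
`2τ` on, where every delayed time is nonnegative. -/
theorem tendsto_zero_of_dissipation {f : ℝ → ℝ} {L c : ℝ} (hc : 0 < c) (hf : Continuous f)
    (hle : ∀ t, c * f t ^ 2 ≤ S.dissipation t)
    (hL : ∀ s t, S.τ + S.τ ≤ s → s ≤ t → |f t - f s| ≤ L * (t - s)) :
    Tendsto f atTop (𝓝 0) := by
  have hτ := S.τ_pos
  refine tendsto_zero_of_lipschitz_of_integral_sq_le (T₀ := S.τ + S.τ) hf hL
    (I := (S.initialEnergy + S.bound * ∫ t in Set.Ioi (0 : ℝ), S.gain t) / c) fun T hT => ?_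
  rw [le_div_iff₀ hc, mul_comm, ← intervalIntegral.integral_const_mul]
  have ic : ∀ a b, IntervalIntegrable (fun t => c * f t ^ 2) volume a b := fun a b =>
    (continuous_const.mul (hf.pow 2)).intervalIntegrable a b
  have h1 : ∫ t in (S.τ + S.τ)..T, c * f t ^ 2 ≤ ∫ t in (0 : ℝ)..T, c * f t ^ 2 :=
    intervalIntegral.integral_mono_interval (by linarith) hT le_rfl
      (ae_of_all _ fun t => by positivity) (ic _ _)
  have h2 : ∫ t in (0 : ℝ)..T, c * f t ^ 2 ≤ ∫ t in (0 : ℝ)..T, S.dissipation t :=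
    intervalIntegral.integral_mono_on (by linarith) (ic _ _)
      (S.continuous_dissipation.intervalIntegrable _ _) fun t _ => hle t
  exact h1.trans (h2.trans (S.integral_dissipation_le (by linarith)))

theorem tendsto_u_sub_v : Tendsto (fun t => S.u t - S.v t) atTop (𝓝 0) := by
  obtain ⟨L, hL⟩ := S.exists_lipschitz
  have hτ := S.τ_pos
  have h2 := S.one_sub_σ_sq_pos
  refine S.tendsto_zero_of_dissipation (L := 2 * L) S.one_sub_ρ_sq_pos
    (S.continuous_u.sub S.continuous_v) (fun t => ?_) fun s t hs hst => ?_
  · have : 0 ≤ (1 - S.σ ^ 2) * (S.w (t - S.τ) - S.q t) ^ 2 + (S.z (t - S.τ) - S.u t) ^ 2 := by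
      positivity
    unfold dissipation
    linarith
  · obtain ⟨e1, e2, e3⟩ := hL s t (by linarith) hst
    have := abs_sub (S.u t - S.u s) (S.v t - S.v s)
    rw [show S.u t - S.v t - (S.u s - S.v s) = S.u t - S.u s - (S.v t - S.v s) by ring]
    linarith

theorem tendsto_w_shift_sub_q : Tendsto (fun t => S.w (t - S.τ) - S.q t) atTop (𝓝 0) := by
  obtain ⟨L, hL⟩ := S.exists_lipschitz
  have hτ := S.τ_pos
  have h1 := S.one_sub_ρ_sq_pos
  have hw := S.continuous_w
  have hq := S.continuous_q
  refine S.tendsto_zero_of_dissipation (L := 4 * L) S.one_sub_σ_sq_pos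
    (by fun_prop) (fun t => ?_) fun s t hs hst => ?_
  · have : 0 ≤ (1 - S.ρ ^ 2) * (S.u t - S.v t) ^ 2 + (S.z (t - S.τ) - S.u t) ^ 2 := by
      positivity
    unfold dissipation
    linarith
  · obtain ⟨e1, e2, e3⟩ := hL s t (by linarith) hst
    obtain ⟨d1, d2, d3⟩ := hL (s - S.τ) (t - S.τ) (by linarith) (by linarith)
    rw [sub_sub_sub_cancel_right] at d1 d2 d3
    have hw := S.abs_w_sub_le d1 d3
    have := abs_sub (S.w (t - S.τ) - S.w (s - S.τ)) (S.q t - S.q s)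
    rw [show S.w (t - S.τ) - S.q t - (S.w (s - S.τ) - S.q s)
      = S.w (t - S.τ) - S.w (s - S.τ) - (S.q t - S.q s) by ring]
    linarith

theorem slowlyVarying_v : SlowlyVarying S.v := by
  refine slowlyVarying_of_ae_hasDerivAt S.absCont_v S.hasDerivAt_v_rateV ?_
  simpa using! (S.tendsto_u_sub_v.const_mul (S.kv * (1 + S.ρ))).add S.tendsto_h₁

theorem tendsto_w_add_v : Tendsto (fun t => S.w t + S.v t) atTop (𝓝 0) := by
  have h := S.tendsto_u_sub_v.const_mul S.ρ
  rw [mul_zero] at h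
  refine h.congr fun t => ?_
  unfold w
  ring

theorem tendsto_shift (τ : ℝ) : Tendsto (fun t : ℝ => t - τ) atTop atTop :=
  tendsto_atTop_add_const_right atTop (-τ) tendsto_id

/-- `q + v` is `w + v` at time `t - τ`, minus `w (t - τ) - q t`, plus the increment of the slowly
varying `v` over one delay. -/
theorem tendsto_q_add_v : Tendsto (fun t => S.q t + S.v t) atTop (𝓝 0) := by
  have h := ((S.tendsto_w_add_v.comp (tendsto_shift S.τ)).sub S.tendsto_w_shift_sub_q).add
    (S.slowlyVarying_v.tendsto_shift_sub S.τ_pos)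
  simp only [sub_zero, add_zero] at h
  refine h.congr fun t => ?_
  simp only [Function.comp]
  ring

theorem tendsto_z_sub_v : Tendsto (fun t => S.z t - S.v t) atTop (𝓝 0) := by
  have h := (S.tendsto_w_shift_sub_q.const_mul S.σ).sub S.tendsto_q_add_v
  simp only [mul_zero, sub_zero] at h
  refine h.congr fun t => ?_
  unfold z
  ring

/-- The weighted sum of the states whose rate of change is a difference of delayed waves. -/
def charge (t : ℝ) : ℝ := S.v t / S.kv - S.q t / S.kq + S.ε * S.u t

def sourceCharge (t : ℝ) : ℝ := S.h₁ t / S.kv - S.h₂ t / S.kq + S.h₃ t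

theorem integrableOn_sourceCharge : IntegrableOn S.sourceCharge (Set.Ioi 0) :=
  ((S.integrable_h₁.div_const _).sub (S.integrable_h₂.div_const _)).add S.integrable_h₃

/-- Without sources this is linear conservation: `(1+ρ)(u-v) = u + w` and `(1+σ)(w(t-τ)-q) = w(t-τ)
+ z`, so `u` cancels against the smoothing equation. -/
theorem hasDerivAt_charge : ∀ᵐ t, 0 < t → HasDerivAt S.charge
    (S.w t - S.w (t - S.τ) + (S.z (t - S.τ) - S.z t) + S.sourceCharge t) t := by
  filter_upwards [S.hasDerivAt_v_rateV, S.hasDerivAt_q_rateQ, S.hasDerivAt_u_rateU]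
    with t hv hq hu ht
  have hd := (((hv ht).div_const S.kv).sub ((hq ht).div_const S.kq)).add
    ((hu ht).const_mul S.ε)
  convert! hd using 1
  have h1 := S.kv_pos.ne'
  have h2 := S.kq_pos.ne'
  have h3 := S.ε_pos.ne'
  simp only [rateV, rateQ, rateU, sourceCharge, z]
  generalize S.w (t - S.τ) = wt
  generalize S.w (t - S.τ - S.τ) = wtt
  simp only [w]
  field_simp
  ring

theorem absCont_charge {T : ℝ} (hT : 0 ≤ T) : AbsolutelyContinuousOnInterval S.charge 0 T := by
  have hv := (S.absCont_v T hT).const_mul (1 / S.kv)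
  have hq := (S.absCont_q T hT).const_mul (1 / S.kq)
  have hu := (S.absCont_u T hT).const_mul S.ε
  have heq : S.charge = (fun t => 1 / S.kv * S.v t) - (fun t => 1 / S.kq * S.q t)
      + fun t => S.ε * S.u t := by
    funext t
    simp only [charge, Pi.add_apply, Pi.sub_apply]
    ring
  rw [heq]
  exact (hv.sub hq).add hu

theorem charge_balance {T : ℝ} (hT : 0 ≤ T) :
    S.charge T - (∫ t in (T - S.τ)..T, S.w t) + ∫ t in (T - S.τ)..T, S.z t
      = S.charge 0 - (∫ t in (-S.τ)..0, S.w t) + (∫ t in (-S.τ)..0, S.z t)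
        + ∫ t in (0 : ℝ)..T, S.sourceCharge t := by
  have hw := S.continuous_w
  have hz := S.continuous_z
  have key := (S.absCont_charge hT).integral_eq_sub_of_ae_hasDerivAt hT S.hasDerivAt_charge
  have ii : ∀ f : ℝ → ℝ, Continuous f → IntervalIntegrable f volume 0 T := fun f hf =>
    hf.intervalIntegrable _ _
  have iw := ii _ hw
  have iwt := ii (fun t => S.w (t - S.τ)) (by fun_prop)
  have iz := ii _ hz
  have izt := ii (fun t => S.z (t - S.τ)) (by fun_prop)
  rw [intervalIntegral.integral_add ((iw.sub iwt).add (izt.sub iz))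
      (intervalIntegrable_of_integrableOn_Ioi S.integrableOn_sourceCharge hT),
    intervalIntegral.integral_add (iw.sub iwt) (izt.sub iz),
    intervalIntegral.integral_sub iw iwt, intervalIntegral.integral_sub izt iz] at key
  have sw := integral_comp_sub_add_integral hw S.τ T
  have sz := integral_comp_sub_add_integral hz S.τ T
  linarith

/-- The charge of the equilibrium `v = u = z = 1`, `q = w = -1`; each wave under way contributes
`τ`. -/
def stiffness : ℝ := 1 / S.kv + 1 / S.kq + S.ε + 2 * S.τ

theorem stiffness_pos : 0 < S.stiffness := by
  have := S.kv_pos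
  have := S.kq_pos
  have := S.ε_pos
  have := S.τ_pos
  unfold stiffness
  positivity

/-- The total charge, including that of the waves under way and that of the sources. -/
def totalCharge : ℝ :=
  S.charge 0 - (∫ t in (-S.τ)..0, S.w t) + (∫ t in (-S.τ)..0, S.z t)
    + ∫ t in Set.Ioi (0 : ℝ), S.sourceCharge t

theorem tendsto_integral_window {f g : ℝ → ℝ} (hf : Continuous f) (hg : Continuous g)
    (hs : SlowlyVarying g) (h : Tendsto (fun t => f t - g t) atTop (𝓝 0)) {τ : ℝ} (hτ : 0 < τ) :
    Tendsto (fun t => (∫ s in (t - τ)..t, f s) - τ * g t) atTop (𝓝 0) := by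
  have h1 := (tendsto_integral_window_zero τ h).add (hs.tendsto_integral_window_sub hg hτ)
  rw [add_zero] at h1
  refine h1.congr fun t => ?_
  rw [intervalIntegral.integral_sub (hf.intervalIntegrable _ _) (hg.intervalIntegrable _ _)]
  ring

theorem tendsto_v : Tendsto S.v atTop (𝓝 (S.totalCharge / S.stiffness)) := by
  have hw := tendsto_integral_window (f := fun t => -S.w t) S.continuous_w.neg
    S.continuous_v S.slowlyVarying_v
    (by simpa [sub_eq_add_neg, add_comm] using S.tendsto_w_add_v.neg) S.τ_pos
  have hz := tendsto_integral_window S.continuous_z S.continuous_v S.slowlyVarying_v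
    S.tendsto_z_sub_v S.τ_pos
  have hsrc := intervalIntegral_tendsto_integral_Ioi 0 S.integrableOn_sourceCharge tendsto_id
  have hbal : Tendsto (fun T => S.charge T - (∫ t in (T - S.τ)..T, S.w t)
      + ∫ t in (T - S.τ)..T, S.z t) atTop (𝓝 S.totalCharge) := by
    refine (hsrc.const_add (S.charge 0 - (∫ t in (-S.τ)..0, S.w t)
      + (∫ t in (-S.τ)..0, S.z t))).congr' ?_
    filter_upwards [eventually_ge_atTop 0] with T hT
    exact (S.charge_balance hT).symm
  have hq := S.tendsto_q_add_v.div_const S.kq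
  have hu := S.tendsto_u_sub_v.const_mul S.ε
  -- Removing the vanishing corrections from the balance leaves exactly `stiffness * v`.
  have hall := (((hbal.sub hw).sub hz).add hq).sub hu
  have hfin := hall.div_const S.stiffness
  simp only [zero_div, mul_zero, sub_zero, add_zero] at hfin
  refine hfin.congr fun t => ?_
  rw [div_eq_iff S.stiffness_pos.ne', intervalIntegral.integral_neg]
  unfold charge stiffness
  ring

theorem tendsto_u : Tendsto S.u atTop (𝓝 (S.totalCharge / S.stiffness)) := by
  have h := S.tendsto_u_sub_v.add S.tendsto_v
  simpa using h

theorem tendsto_q : Tendsto S.q atTop (𝓝 (-(S.totalCharge / S.stiffness))) := by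
  have h := S.tendsto_q_add_v.sub S.tendsto_v
  simpa using h

end

end LayerLoop

/-! ### The characteristic matrix: simple zero and residue -/

namespace LayerParams

variable {p : LayerParams}

theorem a₁_sub_a₂ (hp : p.Admissible) : p.a₁ - p.a₂ = 2 * Real.pi * p.c₃ := by
  have := hp.c₁_pos
  have := hp.c₃_pos
  unfold a₁ a₂
  field_simp
  ring

theorem a₁_sub_a₂_pos (hp : p.Admissible) : 0 < p.a₁ - p.a₂ := by
  rw [a₁_sub_a₂ hp]
  have := hp.c₃_pos
  positivity

theorem a₁_pos (hp : p.Admissible) : 0 < p.a₁ := by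
  have := hp.c₁_pos
  have := hp.c₃_pos
  unfold a₁
  positivity

theorem a₅_pos (hp : p.Admissible) : 0 < p.a₅ := by
  have := hp.c₅_pos
  have := hp.c₃_pos
  unfold a₅
  positivity

theorem a₅_lt_two (hp : p.Admissible) : p.a₅ < 2 := by
  have := hp.c₅_pos
  have := hp.c₃_pos
  unfold a₅
  rw [div_lt_iff₀ (by positivity)]
  linarith

theorem a₂_lt (hp : p.Admissible) : p.a₂ < p.a₁ - p.a₂ := by
  have h1 := hp.c₁_pos
  have h3 := hp.c₃_pos
  rw [a₁_sub_a₂ hp, a₂]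
  refine mul_lt_of_lt_one_right (by positivity) ?_
  rw [div_lt_one (by positivity)]
  linarith

theorem g₀_pos (hp : p.Admissible) {ε : ℝ} (hε : 0 < ε) : 0 < p.g₀ ε := by
  have := a₁_sub_a₂_pos hp
  have := a₁_pos hp
  have := a₅_pos hp
  have := hp.r₂_pos
  have := hp.r₄_pos
  have := hp.τ_pos
  unfold g₀
  positivity

theorem charMatrix_eq (p : LayerParams) (ε : ℝ) (s : ℂ) : p.charMatrix ε s =
    !![s + p.a₁ * p.r₂, 0, -(p.a₁ * p.a₀);
       p.a₅ * p.a₁ * p.r₂ * Complex.exp (-(p.τ * s)), s + (p.a₁ - p.a₂) * p.r₄ * p.a₅,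
         -(p.a₂ * p.a₀ * p.a₅ * Complex.exp (-(p.τ * s)));
       p.a₁ * p.r₂ * (p.a₅ - 1) / ((p.a₁ - p.a₂) * p.a₀) * Complex.exp (-(2 * p.τ * s)),
         p.a₅ * p.r₄ / p.a₀ * Complex.exp (-(p.τ * s)),
         s * ε + 1 - p.a₂ * (p.a₅ - 1) / (p.a₁ - p.a₂) * Complex.exp (-(2 * p.τ * s))] := by
  ext i j
  fin_cases i <;> fin_cases j <;>
    simp [charMatrix, matE, matA, matB, matC] <;> ring

theorem det_charMatrix_zero (hp : p.Admissible) (ε : ℝ) : (p.charMatrix ε 0).det = 0 := by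
  have h1 : ((p.a₁ - p.a₂ : ℝ) : ℂ) ≠ 0 := Complex.ofReal_ne_zero.2 (a₁_sub_a₂_pos hp).ne'
  have h2 : (p.a₀ : ℂ) ≠ 0 := Complex.ofReal_ne_zero.2 hp.a₀_ne
  push_cast at h1
  rw [charMatrix_eq, Matrix.det_fin_three]
  simp
  field_simp
  ring

theorem hasDerivAt_exp_neg_mul (c : ℂ) :
    HasDerivAt (fun s : ℂ => Complex.exp (-(c * s))) (-c) 0 := by
  have h := (((hasDerivAt_id (0 : ℂ)).const_mul c).neg).cexp
  simpa using! h

theorem hasDerivAt_det_charMatrix (hp : p.Admissible) (ε : ℝ) :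
    HasDerivAt (fun s : ℂ => (p.charMatrix ε s).det) (p.g₀ ε : ℂ) 0 := by
  have h1 : ((p.a₁ - p.a₂ : ℝ) : ℂ) ≠ 0 := Complex.ofReal_ne_zero.2 (a₁_sub_a₂_pos hp).ne'
  have h2 : (p.a₀ : ℂ) ≠ 0 := Complex.ofReal_ne_zero.2 hp.a₀_ne
  push_cast at h1
  have hid := hasDerivAt_id (0 : ℂ)
  have e₁ := hasDerivAt_exp_neg_mul p.τ
  have e₂ := hasDerivAt_exp_neg_mul (2 * p.τ)
  have d₁₁ := hid.add_const ((p.a₁ : ℂ) * p.r₂)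
  have d₂₁ := e₁.const_mul ((p.a₅ : ℂ) * p.a₁ * p.r₂)
  have d₂₂ := hid.add_const (((p.a₁ : ℂ) - p.a₂) * p.r₄ * p.a₅)
  have d₂₃ := (e₁.const_mul ((p.a₂ : ℂ) * p.a₀ * p.a₅)).neg
  have d₃₁ := e₂.const_mul ((p.a₁ : ℂ) * p.r₂ * (p.a₅ - 1) / ((p.a₁ - p.a₂) * p.a₀))
  have d₃₂ := e₁.const_mul ((p.a₅ : ℂ) * p.r₄ / p.a₀)
  have d₃₃ := ((hid.mul_const (ε : ℂ)).add_const 1).sub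
    (e₂.const_mul ((p.a₂ : ℂ) * (p.a₅ - 1) / (p.a₁ - p.a₂)))
  -- The four products of the determinant that survive the zero entry in the first row.
  have hd := ((((d₁₁.mul d₂₂).mul d₃₃).sub ((d₁₁.mul d₂₃).mul d₃₂)).add
    (((d₂₁.const_mul (-((p.a₁ : ℂ) * p.a₀))).mul d₃₂))).sub
    ((d₂₂.const_mul (-((p.a₁ : ℂ) * p.a₀))).mul d₃₁)
  refine (hd.congr_of_eventuallyEq (Eventually.of_forall fun s => ?_)).congr_deriv ?_
  · simp only [charMatrix_eq, Matrix.det_fin_three]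
    simp
  · simp [g₀]
    field_simp
    ring

theorem analyticAt_det_charMatrix (p : LayerParams) (ε : ℝ) :
    AnalyticAt ℂ (fun s : ℂ => (p.charMatrix ε s).det) 0 := by
  have hd : Differentiable ℂ (fun s : ℂ => (p.charMatrix ε s).det) := by
    simp only [charMatrix_eq, Matrix.det_fin_three]
    simp
    fun_prop
  exact hd.analyticAt 0

theorem analyticOrderAt_det_charMatrix (hp : p.Admissible) {ε : ℝ} (hε : 0 < ε) :
    analyticOrderAt (fun s : ℂ => (p.charMatrix ε s).det) 0 = 1 := by
  refine (analyticAt_det_charMatrix p ε).analyticOrderAt_eq_one_of_zero_deriv_ne_zero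
    (det_charMatrix_zero hp ε) ?_
  rw [(hasDerivAt_det_charMatrix hp ε).deriv]
  exact Complex.ofReal_ne_zero.2 (g₀_pos hp hε).ne'

theorem adjugate_charMatrix_zero (hp : p.Admissible) {ε : ℝ} (hε : 0 < ε) :
    (p.charMatrix ε 0).adjugate = (p.g₀ ε : ℂ) • (p.matM ε).map Complex.ofReal := by
  have h1 : ((p.a₁ - p.a₂ : ℝ) : ℂ) ≠ 0 := Complex.ofReal_ne_zero.2 (a₁_sub_a₂_pos hp).ne'
  have h2 : (p.a₀ : ℂ) ≠ 0 := Complex.ofReal_ne_zero.2 hp.a₀_ne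
  have h3 : (p.r₂ : ℂ) ≠ 0 := Complex.ofReal_ne_zero.2 hp.r₂_pos.ne'
  have h4 : (p.r₄ : ℂ) ≠ 0 := Complex.ofReal_ne_zero.2 hp.r₄_pos.ne'
  have hg : (p.g₀ ε : ℂ) ≠ 0 := Complex.ofReal_ne_zero.2 (g₀_pos hp hε).ne'
  push_cast at h1
  rw [charMatrix_eq, Matrix.adjugate_fin_three]
  ext i j
  fin_cases i <;> fin_cases j <;>
    simp [matM, m₁, m₂, m₃] <;> field_simp <;> ring

theorem continuous_charMatrix (p : LayerParams) (ε : ℝ) : Continuous (p.charMatrix ε) := by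
  unfold charMatrix
  fun_prop

/-- By Cramer's rule `s Δ⁻¹ = (det Δ / s)⁻¹ adj Δ`, and `det Δ / s` is the slope of the determinant
at its zero, with limit `g₀`. -/
theorem tendsto_residue (hp : p.Admissible) {ε : ℝ} (hε : 0 < ε) (t : ℝ) :
    Tendsto (fun s : ℂ => s • (Complex.exp (s * t) • (p.charMatrix ε s)⁻¹)) (𝓝[≠] 0)
      (𝓝 ((p.matM ε).map Complex.ofReal)) := by
  have hg : (p.g₀ ε : ℂ) ≠ 0 := Complex.ofReal_ne_zero.2 (g₀_pos hp hε).ne'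
  have hslope := (hasDerivAt_iff_tendsto_slope.1 (hasDerivAt_det_charMatrix hp ε)).inv₀ hg
  have hadj : Tendsto (fun s : ℂ => Complex.exp (s * t) • (p.charMatrix ε s).adjugate) (𝓝[≠] 0)
      (𝓝 (Complex.exp (0 * t) • (p.charMatrix ε 0).adjugate)) := by
    have hc : Continuous fun s : ℂ => Complex.exp (s * t) • (p.charMatrix ε s).adjugate := by
      have := (continuous_charMatrix p ε).matrix_adjugate
      fun_prop
    exact (hc.tendsto 0).mono_left nhdsWithin_le_nhds
  have h := hslope.smul hadj
  rw [adjugate_charMatrix_zero hp hε, zero_mul, Complex.exp_zero, one_smul, smul_smul,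
    inv_mul_cancel₀ hg, one_smul] at h
  refine h.congr fun s => ?_
  rw [Matrix.inv_def, Ring.inverse_eq_inv', slope_def_field, det_charMatrix_zero hp, sub_zero,
    sub_zero, inv_div, smul_comm (Complex.exp (s * t)), smul_smul s, div_eq_mul_inv]

end LayerParams

theorem AbsolutelyContinuousOnInterval.of_dist_le_mul {X Y : Type*} [PseudoMetricSpace X]
    [PseudoMetricSpace Y] {f : ℝ → X} {g : ℝ → Y} {a b C : ℝ}
    (hf : AbsolutelyContinuousOnInterval f a b)
    (hg : ∀ s ∈ Set.uIcc a b, ∀ t ∈ Set.uIcc a b, dist (g s) (g t) ≤ C * dist (f s) (f t)) :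
    AbsolutelyContinuousOnInterval g a b := by
  have h := Tendsto.const_mul C hf
  rw [mul_zero] at h
  refine squeeze_zero' (Eventually.of_forall fun E => Finset.sum_nonneg fun i _ => dist_nonneg)
    ?_ h
  filter_upwards [mem_inf_of_right (mem_principal_self _)] with E hE
  rw [Finset.mul_sum]
  exact Finset.sum_le_sum fun i hi => hg _ (hE.1 i hi).1 _ (hE.1 i hi).2

/-! ### Reduction of the delay system to the layer loop -/

namespace LayerParams

noncomputable section

variable {p : LayerParams} {ε : ℝ} {φ h x : ℝ → Fin 3 → ℝ}

theorem matE_mulVec (ε : ℝ) (y : Fin 3 → ℝ) : matE ε *ᵥ y = ![y 0, y 1, ε * y 2] := by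
  ext i
  fin_cases i <;> simp [matE, Matrix.mulVec_diagonal]

theorem matA_mulVec (p : LayerParams) (y : Fin 3 → ℝ) : p.matA *ᵥ y =
    ![-(p.a₁ * p.r₂) * y 0 + p.a₁ * p.a₀ * y 2, -((p.a₁ - p.a₂) * p.r₄ * p.a₅) * y 1, -y 2] := by
  ext i
  fin_cases i <;> simp [matA, Matrix.mulVec, dotProduct, Fin.sum_univ_three]

theorem matB_mulVec (p : LayerParams) (y : Fin 3 → ℝ) : p.matB *ᵥ y =
    ![0, -(p.a₅ * p.a₁ * p.r₂) * y 0 + p.a₂ * p.a₀ * p.a₅ * y 2,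
      -(p.a₅ * p.r₄ / p.a₀) * y 1] := by
  ext i
  fin_cases i <;> simp [matB, Matrix.mulVec, dotProduct, Fin.sum_univ_three]

theorem matC_mulVec (p : LayerParams) (y : Fin 3 → ℝ) : p.matC *ᵥ y =
    ![0, 0, -(p.a₁ * p.r₂ * (p.a₅ - 1) / ((p.a₁ - p.a₂) * p.a₀)) * y 0
      + p.a₂ * (p.a₅ - 1) / (p.a₁ - p.a₂) * y 2] := by
  ext i
  fin_cases i <;> simp [matC, Matrix.mulVec, dotProduct, Fin.sum_univ_three]

/-- `M(ε)` has rank one. -/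
theorem matM_mulVec (hp : p.Admissible) (hε : 0 < ε) (y : Fin 3 → ℝ) : p.matM ε *ᵥ y =
    ((y 0 - y 1 + p.a₀ * (p.a₁ - p.a₂) * y 2) / (p.a₁ - p.a₂) /
      (1 / (p.r₂ * (p.a₁ - p.a₂)) + 1 / (p.r₄ * (p.a₁ - p.a₂)) + ε + 2 * p.τ)) •
        ![1 / p.r₂, -(1 / p.r₄), 1 / p.a₀] := by
  have hb := a₁_sub_a₂_pos hp
  have h1 := a₁_pos hp
  have h5 := a₅_pos hp
  have h2 := hp.r₂_pos
  have h4 := hp.r₄_pos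
  have h0 := hp.a₀_ne
  have hτ := hp.τ_pos
  have hg := (g₀_pos hp hε).ne'
  -- The stiffness of the loop is a multiple of `g₀`, the derivative of the determinant; here the
  -- limit and the residue meet.
  have hs : 1 / (p.r₂ * (p.a₁ - p.a₂)) + 1 / (p.r₄ * (p.a₁ - p.a₂)) + ε + 2 * p.τ
      = p.g₀ ε / (p.a₁ * p.a₅ * p.r₂ * p.r₄ * (p.a₁ - p.a₂)) := by
    unfold g₀
    generalize p.a₁ - p.a₂ = b at *
    field_simp
    ring
  rw [hs]
  ext i
  fin_cases i <;>
    simp [matM, m₁, m₂, m₃, Matrix.mulVec, dotProduct, Fin.sum_univ_three] <;>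
    generalize p.a₁ - p.a₂ = b at * <;> field_simp <;> ring

/-- The `i`-th component of `x`, extended continuously to the left of `-2τ`. -/
def component (p : LayerParams) (x : ℝ → Fin 3 → ℝ) (i : Fin 3) (t : ℝ) : ℝ :=
  x (max t (-(2 * p.τ))) i

theorem component_of_le {i : Fin 3} {t : ℝ} (ht : -(2 * p.τ) ≤ t) :
    p.component x i t = x t i := by
  rw [component, max_eq_left ht]

namespace IsSolution

theorem continuous_component (hx : p.IsSolution ε φ h x)
    (i : Fin 3) : Continuous (p.component x i) := by
  have h1 : Continuous fun t : ℝ => x (max t (-(2 * p.τ))) :=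
    hx.continuousOn.comp_continuous (by fun_prop) fun t => Set.mem_Ici.2 (le_max_right _ _)
  exact (continuous_apply i).comp h1

theorem absCont_component (hx : p.IsSolution ε φ h x)
    (hp : p.Admissible) (hε : 0 < ε) (i : Fin 3) {T : ℝ} (hT : 0 ≤ T) :
    AbsolutelyContinuousOnInterval (p.component x i) 0 T := by
  have hτ := hp.τ_pos
  -- The constant `1 + 1 / ε` serves all components: `1` suffices for the first two, `1 / ε` for the
  -- third.
  refine (hx.absCont T hT).of_dist_le_mul (C := 1 + 1 / ε) fun s hs t ht => ?_
  rw [Set.uIcc_of_le hT] at hs ht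
  rw [component_of_le (by linarith [hs.1]), component_of_le (by linarith [ht.1])]
  have hd := dist_le_pi_dist (matE ε *ᵥ x s) (matE ε *ᵥ x t) i
  set D := dist (matE ε *ᵥ x s) (matE ε *ᵥ x t)
  have hD : 0 ≤ D := dist_nonneg
  have hD' : 0 ≤ 1 / ε * D := by positivity
  rw [matE_mulVec, matE_mulVec] at hd
  have hlast : ε * dist (x s 2) (x t 2) ≤ D → dist (x s 2) (x t 2) ≤ 1 / ε * D := by
    intro hle
    rw [one_div_mul_eq_div, le_div_iff₀ hε, mul_comm]
    exact hle
  rw [add_mul, one_mul]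
  fin_cases i
  · exact le_add_of_le_of_nonneg (by simpa using hd) hD'
  · exact le_add_of_le_of_nonneg (by simpa using hd) hD'
  · refine le_add_of_nonneg_of_le hD (hlast ?_)
    simpa [Real.dist_eq, ← mul_sub, abs_mul, abs_of_pos hε] using hd

theorem hasDerivAt_component (hx : p.IsSolution ε φ h x)
    (hp : p.Admissible) (hε : 0 < ε) : ∀ᵐ t : ℝ, 0 < t →
    HasDerivAt (p.component x 0) (-(p.a₁ * p.r₂) * p.component x 0 t
      + p.a₁ * p.a₀ * p.component x 2 t + h t 0) t ∧
    HasDerivAt (p.component x 1) (-((p.a₁ - p.a₂) * p.r₄ * p.a₅) * p.component x 1 t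
      + (-(p.a₅ * p.a₁ * p.r₂) * p.component x 0 (t - p.τ)
        + p.a₂ * p.a₀ * p.a₅ * p.component x 2 (t - p.τ)) + h t 1) t ∧
    HasDerivAt (p.component x 2) ((-p.component x 2 t
      + -(p.a₅ * p.r₄ / p.a₀) * p.component x 1 (t - p.τ)
      + (-(p.a₁ * p.r₂ * (p.a₅ - 1) / ((p.a₁ - p.a₂) * p.a₀)) * p.component x 0 (t - 2 * p.τ)
        + p.a₂ * (p.a₅ - 1) / (p.a₁ - p.a₂) * p.component x 2 (t - 2 * p.τ)) + h t 2) / ε) t := by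
  have hτ := hp.τ_pos
  filter_upwards [hx.equation] with t ht ht0
  have hd := hasDerivAt_pi.1 (ht ht0)
  have hev : ∀ i, p.component x i =ᶠ[𝓝 t] fun s => x s i := fun i => by
    filter_upwards [lt_mem_nhds ht0] with s hs
    exact component_of_le (by linarith)
  have c₀ : ∀ i, p.component x i t = x t i := fun i => component_of_le (by linarith)
  have c₁ : ∀ i, p.component x i (t - p.τ) = x (t - p.τ) i := fun i =>
    component_of_le (by linarith)
  have c₂ : ∀ i, p.component x i (t - 2 * p.τ) = x (t - 2 * p.τ) i := fun i =>
    component_of_le (by linarith)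
  simp only [c₀, c₁, c₂]
  simp only [matE_mulVec, matA_mulVec, matB_mulVec, matC_mulVec] at hd
  refine ⟨?_, ?_, ?_⟩
  · refine ((hd 0).congr_of_eventuallyEq (hev 0)).congr_deriv ?_
    simp
  · refine ((hd 1).congr_of_eventuallyEq (hev 1)).congr_deriv ?_
    simp
  · refine (((hd 2).div_const ε).congr_of_eventuallyEq ((hev 2).trans ?_)).congr_deriv ?_
    · refine Eventually.of_forall fun s => ?_
      simp [mul_div_cancel_left₀ _ hε.ne']
    · simp

/-- Measurability of `h` is recovered from the equation: almost everywhere `h` is the derivative of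
`E(ε) x`, which is measurable, minus a continuous function. The exponential bound does the rest. -/
theorem integrableOn_source (hx : p.IsSolution ε φ h x) (hp : p.Admissible) {K β : ℝ} (hβ : 0 < β)
    (hh : ∀ t : ℝ, 0 ≤ t → ‖h t‖ ≤ K * Real.exp (-(β * t))) :
    IntegrableOn h (Set.Ioi 0) := by
  have hτ := hp.τ_pos
  have hdom : IntegrableOn (fun t : ℝ => K * Real.exp (-(β * t))) (Set.Ioi 0) := by
    have he := (exp_neg_integrableOn_Ioi 0 hβ).const_mul K
    simp only [neg_mul] at he
    exact he
  refine Integrable.mono' hdom ?_ ?_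
  · set y : ℝ → Fin 3 → ℝ := fun t i => p.component x i t with hy
    have hyc : Continuous y := continuous_pi fun i => hx.continuous_component i
    have hyx : ∀ t, -(2 * p.τ) ≤ t → x t = y t := fun t ht => by
      ext i
      exact (component_of_le ht).symm
    have hm : AEStronglyMeasurable (fun t => deriv (fun u => matE ε *ᵥ x u) t
        - (p.matA *ᵥ y t + p.matB *ᵥ y (t - p.τ) + p.matC *ᵥ y (t - 2 * p.τ)))
        (volume.restrict (Set.Ioi 0)) := by
      refine (stronglyMeasurable_deriv _).aestronglyMeasurable.sub ?_
      exact Continuous.aestronglyMeasurable (by fun_prop)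
    refine hm.congr ?_
    filter_upwards [ae_restrict_of_ae hx.equation, ae_restrict_mem measurableSet_Ioi] with t ht ht0
    have ht0' : 0 < t := ht0
    rw [(ht ht0).deriv, hyx t (by linarith), hyx (t - p.τ) (by linarith),
      hyx (t - 2 * p.τ) (by linarith), add_sub_cancel_left]
  · filter_upwards [ae_restrict_mem measurableSet_Ioi] with t ht
    exact hh t (le_of_lt ht)

/-- The normalized trajectory of a solution. -/
def toLayerLoop (hx : p.IsSolution ε φ h x)
    (hp : p.Admissible) (hε : 0 < ε) {K β : ℝ} (hK : 0 < K) (hβ : 0 < β)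
    (hh : ∀ t : ℝ, 0 ≤ t → ‖h t‖ ≤ K * Real.exp (-(β * t))) : LayerLoop :=
  have hb := a₁_sub_a₂_pos hp
  have hle : ∀ (c : ℝ) (i : Fin 3) (t : ℝ), 0 < t → |c| ≤ p.r₂ + p.r₄ + |p.a₀| →
      |c * h t i| ≤ (p.r₂ + p.r₄ + |p.a₀|) * K := fun c i t ht hc => by
    rw [abs_mul]
    refine mul_le_mul hc ?_ (abs_nonneg _) ((abs_nonneg _).trans hc)
    refine (norm_le_pi_norm (h t) i).trans ((hh t ht.le).trans ?_)
    refine mul_le_of_le_one_right hK.le (Real.exp_le_one_iff.2 ?_)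
    have := mul_pos hβ ht
    linarith
  have hlim : ∀ (c : ℝ) (i : Fin 3), Tendsto (fun t => c * h t i) atTop (𝓝 0) := fun c i => by
    have h1 : Tendsto (fun t : ℝ => K * Real.exp (-(β * t))) atTop (𝓝 0) := by
      simpa using (Real.tendsto_exp_neg_atTop_nhds_zero.comp
        (tendsto_id.const_mul_atTop hβ)).const_mul K
    have h2 : Tendsto (fun t => h t i) atTop (𝓝 0) := by
      refine squeeze_zero_norm' ?_ h1
      filter_upwards [eventually_ge_atTop 0] with t ht
      exact (norm_le_pi_norm (h t) i).trans (hh t ht)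
    simpa using h2.const_mul c
  have h_int : ∀ (c : ℝ) (i : Fin 3), IntegrableOn (fun t => c * h t i) (Set.Ioi 0) := fun c i =>
    (Integrable.eval (hx.integrableOn_source hp hβ hh) i).const_mul c
  -- With this choice `1 + ρ = a₁ / (a₁ - a₂)` and `1 + σ = a₅`.
  { ρ := p.a₂ / (p.a₁ - p.a₂)
    σ := p.a₅ - 1
    kv := p.r₂ * (p.a₁ - p.a₂)
    kq := p.r₄ * (p.a₁ - p.a₂)
    ε := ε
    τ := p.τ
    v := fun t => p.r₂ * p.component x 0 t
    q := fun t => p.r₄ * p.component x 1 t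
    u := fun t => p.a₀ * p.component x 2 t
    h₁ := fun t => p.r₂ * h t 0
    h₂ := fun t => p.r₄ * h t 1
    h₃ := fun t => p.a₀ * h t 2
    K := (p.r₂ + p.r₄ + |p.a₀|) * K
    neg_one_lt_ρ := by
      rw [lt_div_iff₀ hb]
      linarith [a₁_pos hp]
    ρ_lt_one := (div_lt_one hb).2 (a₂_lt hp)
    neg_one_lt_σ := by linarith [a₅_pos hp]
    σ_lt_one := by linarith [a₅_lt_two hp]
    kv_pos := mul_pos hp.r₂_pos hb
    kq_pos := mul_pos hp.r₄_pos hb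
    ε_pos := hε
    τ_pos := hp.τ_pos
    continuous_v := continuous_const.mul (hx.continuous_component 0)
    continuous_q := continuous_const.mul (hx.continuous_component 1)
    continuous_u := continuous_const.mul (hx.continuous_component 2)
    absCont_v := fun T hT => (hx.absCont_component hp hε 0 hT).const_mul _
    absCont_q := fun T hT => (hx.absCont_component hp hε 1 hT).const_mul _
    absCont_u := fun T hT => (hx.absCont_component hp hε 2 hT).const_mul _
    integrable_h₁ := h_int _ _
    integrable_h₂ := h_int _ _
    integrable_h₃ := h_int _ _
    abs_h₁_le := fun t ht => hle _ _ t ht (by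
      rw [abs_of_pos hp.r₂_pos]
      linarith [hp.r₄_pos, abs_nonneg p.a₀])
    abs_h₂_le := fun t ht => hle _ _ t ht (by
      rw [abs_of_pos hp.r₄_pos]
      linarith [hp.r₂_pos, abs_nonneg p.a₀])
    abs_h₃_le := fun t ht => hle _ _ t ht (by linarith [hp.r₂_pos, hp.r₄_pos])
    tendsto_h₁ := hlim _ _
    tendsto_h₂ := hlim _ _
    tendsto_h₃ := hlim _ _
    hasDerivAt_v := by
      filter_upwards [hx.hasDerivAt_component hp hε] with t ht ht0
      refine ((ht ht0).1.const_mul p.r₂).congr_deriv ?_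
      field_simp
      ring
    hasDerivAt_q := by
      filter_upwards [hx.hasDerivAt_component hp hε] with t ht ht0
      refine ((ht ht0).2.1.const_mul p.r₄).congr_deriv ?_
      field_simp
      ring
    hasDerivAt_u := by
      filter_upwards [hx.hasDerivAt_component hp hε] with t ht ht0
      refine ((ht ht0).2.2.const_mul p.a₀).congr_deriv ?_
      have h0 := hp.a₀_ne
      rw [show t - p.τ - p.τ = t - 2 * p.τ by ring]
      field_simp
      ring }

theorem integral_component (hx : p.IsSolution ε φ h x)
    (hφ : ContinuousOn φ (Set.Icc (-(2 * p.τ)) 0)) {a : ℝ} (ha : 0 ≤ a)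
    (ha' : a ≤ 2 * p.τ) (i : Fin 3) :
    ∫ t in (-a)..0, p.component x i t = (∫ θ in (0 : ℝ)..a, φ (θ - a)) i := by
  rw [intervalIntegral.integral_comp_sub_right, zero_sub, sub_self]
  have h_int : IntervalIntegrable φ volume (-a) 0 := by
    refine (hφ.mono ?_).intervalIntegrable
    rw [Set.uIcc_of_le (by linarith)]
    exact Set.Icc_subset_Icc_left (by linarith)
  have hproj := (ContinuousLinearMap.proj (R := ℝ)
    (φ := fun _ : Fin 3 => ℝ) i).intervalIntegral_comp_comm h_int
  simp only [ContinuousLinearMap.proj_apply] at hproj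
  rw [← hproj]
  refine intervalIntegral.integral_congr fun t ht => ?_
  rw [Set.uIcc_of_le (by linarith)] at ht
  have ht' : -(2 * p.τ) ≤ t := by linarith [ht.1]
  simp only [component_of_le ht', hx.initial t ⟨ht', ht.2⟩]

theorem totalCharge_toLayerLoop (hx : p.IsSolution ε φ h x)
    (hp : p.Admissible) (hε : 0 < ε) {K β : ℝ} (hK : 0 < K)
    (hβ : 0 < β) (hh : ∀ t : ℝ, 0 ≤ t → ‖h t‖ ≤ K * Real.exp (-(β * t)))
    (hφ : ContinuousOn φ (Set.Icc (-(2 * p.τ)) 0)) {y : Fin 3 → ℝ}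
    (hy : y = matE ε *ᵥ φ 0 + p.matB *ᵥ (∫ θ in (0 : ℝ)..p.τ, φ (θ - p.τ))
      + p.matC *ᵥ (∫ θ in (0 : ℝ)..(2 * p.τ), φ (θ - 2 * p.τ))
      + ∫ θ in Set.Ioi (0 : ℝ), h θ) :
    (hx.toLayerLoop hp hε hK hβ hh).totalCharge
      = (y 0 - y 1 + p.a₀ * (p.a₁ - p.a₂) * y 2) / (p.a₁ - p.a₂) := by
  set S := hx.toLayerLoop hp hε hK hβ hh with hS
  have hb := (a₁_sub_a₂_pos hp).ne'
  have h2 := hp.r₂_pos.ne'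
  have h4 := hp.r₄_pos.ne'
  have h0 := hp.a₀_ne
  have hτ := hp.τ_pos
  have iφ := fun i => hx.integral_component hφ hτ.le (by linarith) i
  have iψ := fun i => hx.integral_component hφ (a := 2 * p.τ) (by linarith) le_rfl i
  have hwc := S.continuous_w
  have hcc := fun i => hx.continuous_component i
  have iw : ∀ a : ℝ, ∫ t in a..0, S.w t = p.a₂ / (p.a₁ - p.a₂) * (p.a₀ *
      ∫ t in a..0, p.component x 2 t) - (1 + p.a₂ / (p.a₁ - p.a₂)) * (p.r₂ *
      ∫ t in a..0, p.component x 0 t) := by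
    intro a
    simp only [← intervalIntegral.integral_const_mul]
    rw [← intervalIntegral.integral_sub]
    · rfl
    · exact Continuous.intervalIntegrable (by fun_prop) _ _
    · exact Continuous.intervalIntegrable (by fun_prop) _ _
  -- The part over `[-2τ, 0]` produces the `C` term; the part over `[-τ, 0]` joins the other
  -- integral of `w` in the `B` term.
  have iwshift : ∫ t in (-p.τ)..0, S.w (t - p.τ)
      = (∫ t in (-(2 * p.τ))..0, S.w t) - ∫ t in (-p.τ)..0, S.w t := by
    rw [intervalIntegral.integral_comp_sub_right, zero_sub,
      show -p.τ - p.τ = -(2 * p.τ) by ring, eq_sub_iff_add_eq]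
    exact intervalIntegral.integral_add_adjacent_intervals (hwc.intervalIntegrable _ _)
      (hwc.intervalIntegrable _ _)
  have iz : ∫ t in (-p.τ)..0, S.z t = (p.a₅ - 1) * (∫ t in (-p.τ)..0, S.w (t - p.τ))
      - (1 + (p.a₅ - 1)) * (p.r₄ * ∫ t in (-p.τ)..0, p.component x 1 t) := by
    simp only [← intervalIntegral.integral_const_mul]
    rw [← intervalIntegral.integral_sub]
    · rfl
    · exact Continuous.intervalIntegrable (by fun_prop) _ _
    · exact Continuous.intervalIntegrable (by fun_prop) _ _
  have h_int := hx.integrableOn_source hp hβ hh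
  have h_int_apply : ∀ i, IntegrableOn (fun t => h t i) (Set.Ioi 0) := fun i =>
    Integrable.eval h_int i
  have ih : ∀ i, ∫ t in Set.Ioi (0 : ℝ), h t i = (∫ t in Set.Ioi (0 : ℝ), h t) i := fun i =>
    (eval_integral (fun j => h_int_apply j) i).symm
  have isrc : ∫ t in Set.Ioi (0 : ℝ), S.sourceCharge t
      = p.r₂ * (∫ t in Set.Ioi (0 : ℝ), h t 0) / (p.r₂ * (p.a₁ - p.a₂))
        - p.r₄ * (∫ t in Set.Ioi (0 : ℝ), h t 1) / (p.r₄ * (p.a₁ - p.a₂))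
        + p.a₀ * ∫ t in Set.Ioi (0 : ℝ), h t 2 := by
    have e₁ := ((h_int_apply 0).const_mul p.r₂).div_const (p.r₂ * (p.a₁ - p.a₂))
    have e₂ := ((h_int_apply 1).const_mul p.r₄).div_const (p.r₄ * (p.a₁ - p.a₂))
    have e₃ := (h_int_apply 2).const_mul p.a₀
    simp only [← integral_const_mul, ← integral_div]
    rw [← integral_sub e₁ e₂]
    exact integral_add (e₁.sub e₂) e₃
  have hinit : ∀ i, p.component x i 0 = φ 0 i := fun i => by
    rw [component_of_le (by linarith), hx.initial 0 ⟨by linarith, le_rfl⟩]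
  have hcharge : S.charge 0 = p.r₂ * φ 0 0 / (p.r₂ * (p.a₁ - p.a₂))
      - p.r₄ * φ 0 1 / (p.r₄ * (p.a₁ - p.a₂)) + ε * (p.a₀ * φ 0 2) := by
    rw [← hinit, ← hinit, ← hinit]
    rfl
  have htot : S.totalCharge = S.charge 0 - (∫ t in (-p.τ)..0, S.w t) + (∫ t in (-p.τ)..0, S.z t)
    + ∫ t in Set.Ioi (0 : ℝ), S.sourceCharge t := rfl
  rw [htot, iz, iwshift, iw, iw, isrc, hcharge, ih, ih, ih, iφ, iφ, iφ, iψ, iψ]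
  rw [hy, matE_mulVec, matB_mulVec, matC_mulVec]
  simp only [Pi.add_apply]
  simp
  field_simp
  ring

/-- The loop tends to a multiple of `(v, q, u) = (1, -1, 1)`; undoing the scaling gives `(1/r₂,
-1/r₄, 1/a₀)`, which spans the range of `M(ε)`. -/
theorem tendsto_limit (hx : p.IsSolution ε φ h x)
    (hp : p.Admissible) (hε : 0 < ε) {K β : ℝ} (hK : 0 < K)
    (hβ : 0 < β) (hh : ∀ t : ℝ, 0 ≤ t → ‖h t‖ ≤ K * Real.exp (-(β * t)))
    (hφ : ContinuousOn φ (Set.Icc (-(2 * p.τ)) 0)) :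
    Tendsto x atTop (𝓝 (p.matM ε *ᵥ (matE ε *ᵥ φ 0
      + p.matB *ᵥ (∫ θ in (0 : ℝ)..p.τ, φ (θ - p.τ))
      + p.matC *ᵥ (∫ θ in (0 : ℝ)..(2 * p.τ), φ (θ - 2 * p.τ)))
      + p.matM ε *ᵥ (∫ θ in Set.Ioi (0 : ℝ), h θ))) := by
  rw [← Matrix.mulVec_add, matM_mulVec hp hε,
    ← hx.totalCharge_toLayerLoop hp hε hK hβ hh hφ rfl]
  set S := hx.toLayerLoop hp hε hK hβ hh with hS
  have hstiff : 1 / (p.r₂ * (p.a₁ - p.a₂)) + 1 / (p.r₄ * (p.a₁ - p.a₂)) + ε + 2 * p.τ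
    = S.stiffness := rfl
  rw [hstiff, tendsto_pi_nhds]
  have hcomp : ∀ (c : ℝ) (i : Fin 3), c ≠ 0 →
      (fun t => c * p.component x i t * (1 / c)) =ᶠ[atTop] fun t => x t i := fun c i hc => by
    filter_upwards [eventually_ge_atTop (-(2 * p.τ))] with t ht
    rw [component_of_le ht]
    field_simp
  intro i
  fin_cases i
  · exact (S.tendsto_v.mul_const (1 / p.r₂)).congr' (hcomp _ 0 hp.r₂_pos.ne')
  · have hq := (S.tendsto_q.mul_const (1 / p.r₄)).congr' (hcomp _ 1 hp.r₄_pos.ne')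
    rw [neg_mul, ← mul_neg] at hq
    exact hq
  · exact (S.tendsto_u.mul_const (1 / p.a₀)).congr' (hcomp _ 2 hp.a₀_ne)

end IsSolution

end

end LayerParams

/-- Zero is a simple root of `det Δ(ε, ·)`, the residue of `e^{st} Δ(ε, s)⁻¹` at this simple pole
is the explicit matrix `M(ε)`, and every solution of the perturbed system with continuous initial
function and exponentially bounded source converges to the stated limit. -/
theorem lemmal (p : LayerParams) (hp : p.Admissible) (ε : ℝ) (hε : 0 < ε) :
    analyticOrderAt (fun s : ℂ => (p.charMatrix ε s).det) 0 = 1 ∧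
    (∀ t : ℝ, Tendsto (fun s : ℂ => s • (Complex.exp (s * t) • (p.charMatrix ε s)⁻¹)) (𝓝[≠] 0)
      (𝓝 ((p.matM ε).map Complex.ofReal))) ∧
    ∀ (h : ℝ → Fin 3 → ℝ) (K₁ β : ℝ), 0 < K₁ → 0 < β →
      (∀ t : ℝ, 0 ≤ t → ‖h t‖ ≤ K₁ * Real.exp (-(β * t))) →
      ∀ φ : ℝ → Fin 3 → ℝ, ContinuousOn φ (Set.Icc (-(2 * p.τ)) 0) →
      ∀ x : ℝ → Fin 3 → ℝ, p.IsSolution ε φ h x →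
        IntegrableOn h (Set.Ioi 0) ∧
        Tendsto x atTop (𝓝 (p.matM ε *ᵥ
          (LayerParams.matE ε *ᵥ φ 0
            + p.matB *ᵥ (∫ θ in (0 : ℝ)..p.τ, φ (θ - p.τ))
            + p.matC *ᵥ (∫ θ in (0 : ℝ)..(2 * p.τ), φ (θ - 2 * p.τ)))
          + p.matM ε *ᵥ (∫ θ in Set.Ioi (0 : ℝ), h θ))) :=
  ⟨LayerParams.analyticOrderAt_det_charMatrix hp hε, LayerParams.tendsto_residue hp hε,
    fun _ _ _ hK hβ hh _ hφ _ hx =>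
      ⟨hx.integrableOn_source hp hβ hh, hx.tendsto_limit hp hε hK hβ hh hφ⟩⟩
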